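/- Let $\mathcal H$ be a complex separable Hilbert space and $\mathcal T(\mathcal H)$ the space of trace class operators on $\mathcal H$ with the trace norm. A state is a positive operator of trace one. An operation is a completely positive linear map $\Phi$ on $\mathcal T(\mathcal H)$ with $0\le \operatorname{tr}[\Phi(\varrho)]\le 1$ for every state $\varrho$. An instrument is a map $A\mapsto\mathcal J_A$ from a $\sigma$-algebra of subsets of a set $\Omega$ to the operations on $\mathcal T(\mathcal H)$ which is $\sigma$-additive (for pairwise disjoint $A_1,A_2,\dots$ and every $T$, $\sum_n\mathcal J_{A_n}(T)=\mathcal J_{\bigcup_n A_n}(T)$ in trace norm) and satisfies $\operatorname{tr}[\mathcal J_\Omega(\varrho)]=1$ for every state $\varrho$. Two operations are coexistent if both belong to the range of one instrument. Let $\Phi$ and $\Psi$ be operations. Then $\Phi$ and $\Psi$ are coexistent if and only if there are a countable (finite or infinite) family $\{X_j\}_{j\in J}$ of bounded operators on $\mathcal H$ and index subsets $J_1,J_2\subseteq J$ such that $$\Phi(T)=\sum_{j\in J_1}X_jTX_j^*,\qquad \Psi(T)=\sum_{j\in J_2}X_jTX_j^*\qquad\text{for all } T\in\mathcal T(\mathcal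 H),$$ with convergence in trace norm, and $$\sum_{j\in J}X_j^*X_j=I$$ in the strong operator topology. If $d=\dim\mathcal H<\infty$ and $\Phi$ and $\Psi$ are coexistent, then $J$ can be chosen with at most $3d^2+1$ elements. -/

import Mathlib

universe w u

noncomputable section

namespace QOp

open scoped InnerProductSpace ComplexOrder

variable {H : Type u} [NormedAddCommGroup H] [InnerProductSpace ℂ H]

/-! ### Trace class operators -/

/-- `T = ∑ n, |x n⟩⟨y n|`, pointwise, with `∑ n, ‖x n‖ * ‖y n‖ < ∞`. -/
structure IsNuclearRep (T : H →L[ℂ] H) (x y : ℕ → H) : Prop where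
  summable : Summable fun n => ‖x n‖ * ‖y n‖
  hasSum : ∀ z : H, HasSum (fun n => ⟪y n, z⟫_ℂ • x n) (T z)

/-- The trace norm `inf {∑ n, ‖x n‖ * ‖y n‖ | T = ∑ n, |x n⟩⟨y n|}` of a trace class operator. -/
def traceNorm (T : H →L[ℂ] H) : ℝ :=
  sInf {r : ℝ | ∃ x y : ℕ → H, IsNuclearRep T x y ∧ r = ∑' n, ‖x n‖ * ‖y n‖}

theorem IsNuclearRep.tsum_nonneg {E : Type u} [NormedAddCommGroup E] (x y : ℕ → E) :
    0 ≤ ∑' n, ‖x n‖ * ‖y n‖ :=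
  _root_.tsum_nonneg fun _ => by positivity

theorem traceNorm_nonneg (T : H →L[ℂ] H) : 0 ≤ traceNorm T := by
  refine Real.sInf_nonneg ?_
  rintro r ⟨x, y, -, rfl⟩
  exact IsNuclearRep.tsum_nonneg x y

theorem IsNuclearRep.traceNorm_le {T : H →L[ℂ] H} {x y : ℕ → H} (h : IsNuclearRep T x y) :
    traceNorm T ≤ ∑' n, ‖x n‖ * ‖y n‖ := by
  refine csInf_le ⟨0, ?_⟩ ⟨x, y, h, rfl⟩
  rintro r ⟨x, y, -, rfl⟩
  exact IsNuclearRep.tsum_nonneg x y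

theorem IsNuclearRep.zero : IsNuclearRep (0 : H →L[ℂ] H) (fun _ => 0) (fun _ => 0) :=
  ⟨by simp, fun z => by simp⟩

theorem IsNuclearRep.smul {T : H →L[ℂ] H} {x y : ℕ → H} (h : IsNuclearRep T x y) (c : ℂ) :
    IsNuclearRep (c • T) (fun n => c • x n) y := by
  refine ⟨?_, fun z => ?_⟩
  · simpa only [norm_smul, mul_assoc] using h.summable.mul_left ‖c‖
  · simpa only [smul_comm c, smul_apply] using (h.hasSum z).const_smul c

theorem hasSum_interleave {E F : Type*} [AddCommMonoid E] [TopologicalSpace E] [ContinuousAdd E]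
    (f : F → E) (g g' : ℕ → F) {a a' : E} (h : HasSum (fun n => f (g n)) a)
    (h' : HasSum (fun n => f (g' n)) a') :
    HasSum (fun n => f (Sum.elim g g' (Equiv.natSumNatEquivNat.symm n))) (a + a') := by
  have h1 : HasSum (fun s : ℕ ⊕ ℕ => f (Sum.elim g g' s)) (a + a') := HasSum.sum h h'
  exact (Equiv.hasSum_iff (f := fun s : ℕ ⊕ ℕ => f (Sum.elim g g' s))
    Equiv.natSumNatEquivNat.symm).mpr h1

theorem IsNuclearRep.add {T S : H →L[ℂ] H} {x y x' y' : ℕ → H} (h : IsNuclearRep T x y)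
    (h' : IsNuclearRep S x' y') :
    ∃ a b : ℕ → H, IsNuclearRep (T + S) a b ∧
      ∑' n, ‖a n‖ * ‖b n‖ = ∑' n, ‖x n‖ * ‖y n‖ + ∑' n, ‖x' n‖ * ‖y' n‖ := by
  have key := hasSum_interleave (fun p : H × H => ‖p.1‖ * ‖p.2‖) (fun n => (x n, y n))
    (fun n => (x' n, y' n)) h.summable.hasSum h'.summable.hasSum
  exact ⟨_, _, ⟨key.summable, fun z => hasSum_interleave (fun p : H × H => ⟪p.2, z⟫_ℂ • p.1)
    (fun n => (x n, y n)) (fun n => (x' n, y' n)) (h.hasSum z) (h'.hasSum z)⟩, key.tsum_eq⟩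

theorem IsNuclearRep.norm_le {T : H →L[ℂ] H} {x y : ℕ → H} (h : IsNuclearRep T x y) :
    ‖T‖ ≤ ∑' n, ‖x n‖ * ‖y n‖ := by
  refine ContinuousLinearMap.opNorm_le_bound _ (IsNuclearRep.tsum_nonneg x y) fun z => ?_
  refine (h.hasSum z).norm_le_of_bounded (h.summable.hasSum.mul_right ‖z‖) fun n => ?_
  rw [norm_smul]
  calc ‖⟪y n, z⟫_ℂ‖ * ‖x n‖ ≤ (‖y n‖ * ‖z‖) * ‖x n‖ := by gcongr; exact norm_inner_le_norm _ _
    _ = ‖x n‖ * ‖y n‖ * ‖z‖ := by ring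

variable (H) in
/-- The trace class operators, as a subspace of the bounded operators: a bounded operator on a
Hilbert space is of trace class iff it is nuclear. -/
def traceClassSubmodule : Submodule ℂ (H →L[ℂ] H) where
  carrier := {T | ∃ x y : ℕ → H, IsNuclearRep T x y}
  zero_mem' := ⟨_, _, IsNuclearRep.zero⟩
  add_mem' := by
    rintro T S ⟨x, y, h⟩ ⟨x', y', h'⟩
    obtain ⟨a, b, hab, -⟩ := h.add h'
    exact ⟨a, b, hab⟩
  smul_mem' := by
    rintro c T ⟨x, y, h⟩
    exact ⟨_, _, h.smul c⟩

variable (H) in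
/-- The space of trace class operators on `H`. It carries the trace norm, not the operator norm. -/
def TraceClass : Type u := traceClassSubmodule H

namespace TraceClass

instance : AddCommGroup (TraceClass H) := inferInstanceAs (AddCommGroup (traceClassSubmodule H))

instance : Module ℂ (TraceClass H) := inferInstanceAs (Module ℂ (traceClassSubmodule H))

/-- The underlying bounded operator of a trace class operator. -/
def toCLM : TraceClass H →ₗ[ℂ] (H →L[ℂ] H) := (traceClassSubmodule H).subtype

theorem toCLM_injective : Function.Injective (toCLM (H := H)) := Subtype.val_injective

theorem exists_rep (T : TraceClass H) : ∃ x y : ℕ → H, IsNuclearRep T.toCLM x y := T.2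

theorem exists_rep_lt (T : TraceClass H) {r : ℝ} (hr : traceNorm T.toCLM < r) :
    ∃ x y : ℕ → H, IsNuclearRep T.toCLM x y ∧ ∑' n, ‖x n‖ * ‖y n‖ < r := by
  obtain ⟨x, y, h⟩ := T.exists_rep
  obtain ⟨s, ⟨x', y', h', rfl⟩, hs⟩ := exists_lt_of_csInf_lt (by exact ⟨_, x, y, h, rfl⟩) hr
  exact ⟨x', y', h', hs⟩

instance : Norm (TraceClass H) := ⟨fun T => traceNorm T.toCLM⟩

theorem norm_def (T : TraceClass H) : ‖T‖ = traceNorm T.toCLM := rfl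

theorem norm_smul_le' (c : ℂ) (T : TraceClass H) : ‖c • T‖ ≤ ‖c‖ * ‖T‖ := by
  refine le_of_forall_pos_le_add fun ε hε => ?_
  obtain ⟨x, y, h, hlt⟩ := T.exists_rep_lt (r := ‖T‖ + ε / (‖c‖ + 1))
    (lt_add_of_pos_right _ (by positivity))
  have h1 := (h.smul c).traceNorm_le
  simp only [norm_smul, mul_assoc, tsum_mul_left] at h1
  rw [norm_def, map_smul]
  have h2 : ‖c‖ * (ε / (‖c‖ + 1)) ≤ ε := by
    rw [mul_div_assoc', div_le_iff₀ (by positivity)]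
    nlinarith [norm_nonneg c]
  nlinarith [norm_nonneg c, mul_le_mul_of_nonneg_left hlt.le (norm_nonneg c)]

theorem normCore : NormedSpace.Core ℂ (TraceClass H) where
  norm_nonneg T := traceNorm_nonneg _
  norm_smul c T := by
    refine le_antisymm (norm_smul_le' c T) ?_
    rcases eq_or_ne c 0 with rfl | hc
    · rw [norm_zero, zero_mul]
      exact traceNorm_nonneg _
    · have := norm_smul_le' c⁻¹ (c • T)
      rwa [inv_smul_smul₀ hc, norm_inv, ← div_eq_inv_mul, le_div_iff₀' (norm_pos_iff.mpr hc)]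
        at this
  norm_triangle T S := by
    refine le_of_forall_pos_le_add fun ε hε => ?_
    obtain ⟨x, y, h, hlt⟩ := T.exists_rep_lt (r := ‖T‖ + ε / 2)
      (lt_add_of_pos_right _ (by positivity))
    obtain ⟨x', y', h', hlt'⟩ := S.exists_rep_lt (r := ‖S‖ + ε / 2)
      (lt_add_of_pos_right _ (by positivity))
    obtain ⟨a, b, hab, heq⟩ := h.add h'
    have := hab.traceNorm_le
    rw [norm_def, map_add]
    linarith
  norm_eq_zero_iff T := by
    constructor
    · intro h0
      apply toCLM_injective
      rw [map_zero, ← norm_le_zero_iff]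
      refine le_of_forall_pos_le_add fun ε hε => ?_
      obtain ⟨x, y, h, hlt⟩ := T.exists_rep_lt (r := ‖T‖ + ε) (lt_add_of_pos_right _ hε)
      have := h.norm_le
      linarith
    · rintro rfl
      refine le_antisymm ?_ (traceNorm_nonneg _)
      rw [norm_def, map_zero]
      simpa using (IsNuclearRep.zero (H := H)).traceNorm_le

/-- The trace norm on the trace class operators. -/
instance : NormedAddCommGroup (TraceClass H) := NormedAddCommGroup.ofCore normCore

instance : NormedSpace ℂ (TraceClass H) := NormedSpace.ofCore normCore

variable [CompleteSpace H]

/-- The trace `∑ i, ⟪b i, T (b i)⟫`, for some Hilbert basis `b` of `H`. By `hasSum_trace` below the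
sum converges and does not depend on the basis. -/
def trace (T : TraceClass H) : ℂ :=
  ∑' i, ⟪(exists_hilbertBasis ℂ H).choose_spec.choose i,
    T.toCLM ((exists_hilbertBasis ℂ H).choose_spec.choose i)⟫_ℂ

theorem hasSum_of_rep {ι : Type*} (b : HilbertBasis ι ℂ H) {T : H →L[ℂ] H} {x y : ℕ → H}
    (h : IsNuclearRep T x y) :
    HasSum (fun i => ⟪b i, T (b i)⟫_ℂ) (∑' n, ⟪y n, x n⟫_ℂ) := by
  have hn (n : ℕ) : HasSum (fun i => ⟪y n, b i⟫_ℂ * ⟪b i, x n⟫_ℂ) ⟪y n, x n⟫_ℂ :=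
    b.hasSum_inner_mul_inner (y n) (x n)
  have hsq (v : H) : HasSum (fun i => ‖⟪b i, v⟫_ℂ‖ ^ 2) (‖v‖ ^ 2) := by
    have h1 := b.hasSum_inner_mul_inner v v
    have h2 := h1.mapL Complex.reCLM
    convert! h2 using 1
    · ext i
      have h3 := inner_mul_symm_re_eq_norm (𝕜 := ℂ) v (b i)
      simp only [Complex.reCLM_apply]
      exact (h3.trans (by rw [norm_mul, norm_inner_symm v (b i), sq])).symm
    · rw [Complex.reCLM_apply, inner_self_eq_norm_sq_to_K]
      norm_cast
  have hfin (n : ℕ) (s : Finset ι) :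
      ∑ i ∈ s, ‖⟪y n, b i⟫_ℂ * ⟪b i, x n⟫_ℂ‖ ≤ ‖x n‖ * ‖y n‖ := by
    have hx := sum_le_hasSum s (fun i _ => by positivity) (hsq (x n))
    have hy := sum_le_hasSum s (fun i _ => by positivity) (hsq (y n))
    calc ∑ i ∈ s, ‖⟪y n, b i⟫_ℂ * ⟪b i, x n⟫_ℂ‖
        = ∑ i ∈ s, ‖⟪b i, x n⟫_ℂ‖ * ‖⟪b i, y n⟫_ℂ‖ :=
          Finset.sum_congr rfl fun i _ => by rw [norm_mul, norm_inner_symm (y n), mul_comm]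
      _ ≤ √(∑ i ∈ s, ‖⟪b i, x n⟫_ℂ‖ ^ 2) * √(∑ i ∈ s, ‖⟪b i, y n⟫_ℂ‖ ^ 2) :=
          Real.sum_mul_le_sqrt_mul_sqrt _ _ _
      _ ≤ √(‖x n‖ ^ 2) * √(‖y n‖ ^ 2) := by gcongr
      _ = ‖x n‖ * ‖y n‖ := by simp
  have hsn (n : ℕ) : Summable fun i => ‖⟪y n, b i⟫_ℂ * ⟪b i, x n⟫_ℂ‖ :=
    summable_of_sum_le (fun _ => norm_nonneg _) (hfin n)
  have hprod : Summable fun p : ℕ × ι => ⟪y p.1, b p.2⟫_ℂ * ⟪b p.2, x p.1⟫_ℂ := by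
    refine Summable.of_norm ?_
    rw [summable_prod_of_nonneg fun _ => norm_nonneg _]
    exact ⟨hsn, h.summable.of_nonneg_of_le (fun n => tsum_nonneg fun _ => norm_nonneg _)
      fun n => (hsn n).tsum_le_of_sum_le (hfin n)⟩
  have hi (i : ι) : HasSum (fun n => ⟪y n, b i⟫_ℂ * ⟪b i, x n⟫_ℂ) ⟪b i, T (b i)⟫_ℂ := by
    simpa [inner_smul_right] using (h.hasSum (b i)).mapL (innerSL ℂ (b i))
  have h1 : ∑' n, ⟪y n, x n⟫_ℂ = ∑' p : ℕ × ι, ⟪y p.1, b p.2⟫_ℂ * ⟪b p.2, x p.1⟫_ℂ :=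
    (hprod.hasSum.prod_fiberwise hn).tsum_eq
  rw [h1]
  have h2 := ((Equiv.prodComm ι ℕ).hasSum_iff.mpr hprod.hasSum)
  exact h2.prod_fiberwise hi

theorem hasSum_trace {ι : Type*} (b : HilbertBasis ι ℂ H) (T : TraceClass H) :
    HasSum (fun i => ⟪b i, T.toCLM (b i)⟫_ℂ) T.trace := by
  obtain ⟨x, y, h⟩ := T.exists_rep
  have h1 := hasSum_of_rep (exists_hilbertBasis ℂ H).choose_spec.choose h
  have h2 := hasSum_of_rep b h
  rwa [trace, h1.tsum_eq]

/-- The map `T ↦ X T X*` on the trace class operators. -/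
def conj (X : H →L[ℂ] H) : TraceClass H →ₗ[ℂ] TraceClass H where
  toFun T := ⟨X ∘L T.toCLM ∘L X.adjoint, by
    obtain ⟨x, y, h⟩ := T.exists_rep
    refine ⟨fun n => X (x n), fun n => X (y n), ?_, fun z => ?_⟩
    · refine (h.summable.mul_left (‖X‖ * ‖X‖)).of_nonneg_of_le (fun n => by positivity) fun n => ?_
      calc ‖X (x n)‖ * ‖X (y n)‖ ≤ (‖X‖ * ‖x n‖) * (‖X‖ * ‖y n‖) := by
            gcongr <;> exact X.le_opNorm _
        _ = ‖X‖ * ‖X‖ * (‖x n‖ * ‖y n‖) := by ring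
    · simpa [ContinuousLinearMap.adjoint_inner_right] using (h.hasSum (X.adjoint z)).mapL X⟩
  map_add' T S := toCLM_injective (by
    change X ∘L toCLM (T + S) ∘L X.adjoint =
      X ∘L T.toCLM ∘L X.adjoint + X ∘L S.toCLM ∘L X.adjoint
    ext z
    simp)
  map_smul' c T := toCLM_injective (by
    change X ∘L toCLM (c • T) ∘L X.adjoint = c • (X ∘L T.toCLM ∘L X.adjoint)
    ext z
    simp)

@[simp]
theorem toCLM_conj (X : H →L[ℂ] H) (T : TraceClass H) :
    (conj X T).toCLM = X ∘L T.toCLM ∘L X.adjoint := rfl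

end TraceClass

/-! ### Operations, instruments, coexistence -/

/-- Positivity of the operator matrix `(T i j)` as an operator on `H ⊕ ⋯ ⊕ H = H ⊗ ℂⁿ`. -/
def IsPosBlock {n : ℕ} (T : Fin n → Fin n → TraceClass H) : Prop :=
  ∀ v : Fin n → H, 0 ≤ ∑ i, ∑ j, ⟪v i, (T i j).toCLM (v j)⟫_ℂ

/-- Complete positivity: `Φ ⊗ id` is positive on the trace class operators on `H ⊗ ℂⁿ`, for
every `n`. -/
def IsCompletelyPositive (Φ : TraceClass H →ₗ[ℂ] TraceClass H) : Prop :=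
  ∀ (n : ℕ) (T : Fin n → Fin n → TraceClass H), IsPosBlock T → IsPosBlock fun i j => Φ (T i j)

variable [CompleteSpace H]

/-- A state: a positive operator of trace one. -/
def IsState (ρ : TraceClass H) : Prop :=
  ρ.toCLM.IsPositive ∧ ρ.trace = 1

/-- An operation: a completely positive linear map on the trace class operators such that
`0 ≤ tr (Φ ρ) ≤ 1` for every state `ρ`. -/
structure IsOperation (Φ : TraceClass H →ₗ[ℂ] TraceClass H) : Prop where
  completelyPositive : IsCompletelyPositive Φ
  trace_nonneg : ∀ ρ, IsState ρ → 0 ≤ (Φ ρ).trace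
  trace_le_one : ∀ ρ, IsState ρ → (Φ ρ).trace ≤ 1

/-- An instrument on the measurable space `Ω`: a normalized, `σ`-additive, operation valued map on
the `σ`-algebra of `Ω`; the values at non-measurable sets are irrelevant. The series in
`sigma_additive` converges in trace norm. -/
structure IsInstrument {Ω : Type w} [MeasurableSpace Ω]
    (J : Set Ω → TraceClass H →ₗ[ℂ] TraceClass H) : Prop where
  isOperation : ∀ A, MeasurableSet A → IsOperation (J A)
  sigma_additive : ∀ A : ℕ → Set Ω, (∀ n, MeasurableSet (A n)) →
    Pairwise (fun m n => Disjoint (A m) (A n)) →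
    ∀ T, HasSum (fun n => J (A n) T) (J (⋃ n, A n) T)
  trace_univ : ∀ ρ, IsState ρ → (J Set.univ ρ).trace = 1

/-- `Φ` and `Ψ` are coexistent: both lie in the range of some instrument. -/
def Coexistent (Φ Ψ : TraceClass H →ₗ[ℂ] TraceClass H) : Prop :=
  ∃ (Ω : Type w) (_ : MeasurableSpace Ω) (J : Set Ω → TraceClass H →ₗ[ℂ] TraceClass H),
    IsInstrument J ∧ (∃ A, MeasurableSet A ∧ J A = Φ) ∧ (∃ B, MeasurableSet B ∧ J B = Ψ)

/-- `Φ(·) = ∑ j, X j · (X j)*`, with convergence in trace norm. -/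
def IsKrausSum {ι : Type*} (Φ : TraceClass H →ₗ[ℂ] TraceClass H) (X : ι → H →L[ℂ] H) : Prop :=
  ∀ T, HasSum (fun j => TraceClass.conj (X j) T) (Φ T)

/-- `∑ j, (X j)* (X j) = I`, in the strong operator topology. -/
def IsNormalized {ι : Type*} (X : ι → H →L[ℂ] H) : Prop :=
  ∀ v : H, HasSum (fun j => (X j).adjoint (X j v)) v

end QOp

end

/-!
Two operations with a common instrument `J`, at the sets `A` and `B`, are refined by the values of
`J` at the four atoms `A ∩ B`, `A \ B`, `B \ A`, `(A ∪ B)ᶜ`, and conversely a normalized Kraus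
family is an instrument on its discrete index set. The theorem therefore reduces to Kraus' theorem
for a single operation, with countably many Kraus operators and at most `d ^ 2` in dimension `d`.
The fourth atom is disjoint from `A` and `B`; in finite dimension a single operator
`(I - ∑ j, (X j)* (X j)) ^ (1 / 2)`, the sum over the Kraus operators of the other three, replaces
its family, hence `3 * d ^ 2 + 1` (`Coexistent.exists_finite_kraus`).

For Kraus' theorem (`IsOperation.exists_isKrausSum`), complete positivity says that the operator
valued kernel `(x, y) ↦ Φ |x⟩⟨y|` on `H` is positive semidefinite. Let `E` be the Hilbert space of
functions `H → H` with this reproducing kernel, and `k_x : H → E` its kernel functions, so that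
`⟪k_x v, f⟫ = ⟪v, f x⟫`. Since the kernel is linear in its first variable, the elements of `E` are
linear maps, and they are bounded (`evalCLM`). For a Hilbert basis `b` of `E`, Parseval's identity

  `⟪v, Φ |x⟩⟨y| w⟫ = ⟪k_x v, k_y w⟫ = ∑ i, ⟪v, b i x⟫ * ⟪b i y, w⟫`

is the Kraus decomposition at the rank one operators, with Kraus operators `b i`. As `E` is a space
of linear maps on `H`, it has dimension at most `d ^ 2`, and `b` is countable if `H` is separable.

The passage from rank one to trace class operators needs continuity on both sides. A Kraus sum with
`∑ j, (X j)* (X j) ≤ I` is a contraction for the trace norm, by the Cauchy-Schwarz inequality and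
the completeness of the trace class (`krausMap`). An operation is not assumed to be continuous, but
positivity bounds it on positive operators by the trace, and every trace class operator is a
combination of four positive ones of controlled trace (`IsOperation.norm_inner_le_of_rep`).
-/

noncomputable section

namespace QOp

open scoped InnerProductSpace ComplexOrder

variable {H : Type u} [NormedAddCommGroup H] [InnerProductSpace ℂ H]

theorem inner_self_eq_ofReal (v : H) : ⟪v, v⟫_ℂ = ((‖v‖ ^ 2 : ℝ) : ℂ) := by
  rw [inner_self_eq_norm_sq_to_K]
  norm_cast

namespace TraceClass

/-! ### The Banach space of trace class operators -/

theorem norm_le_of_rep {T : TraceClass H} {x y : ℕ → H} (h : IsNuclearRep T.toCLM x y) :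
    ‖T‖ ≤ ∑' n, ‖x n‖ * ‖y n‖ :=
  h.traceNorm_le

theorem norm_toCLM_le (T : TraceClass H) : ‖T.toCLM‖ ≤ ‖T‖ := by
  refine le_of_forall_pos_le_add fun ε hε => ?_
  obtain ⟨x, y, h, hlt⟩ := T.exists_rep_lt (r := ‖T‖ + ε) (lt_add_of_pos_right _ hε)
  exact h.norm_le.trans hlt.le

variable (H) in
/-- The contractive inclusion of the trace class operators into the bounded operators. -/
def toCLML : TraceClass H →L[ℂ] (H →L[ℂ] H) :=
  toCLM.mkContinuous 1 fun T => by simpa using T.norm_toCLM_le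

@[simp]
theorem toCLML_apply (T : TraceClass H) : toCLML H T = T.toCLM := rfl

/-- A linear map on the trace class operators that is bounded by `C * ∑ n, ‖x n‖ * ‖y n‖` on
`∑ n, |x n⟩⟨y n|` is bounded by `C` with respect to the trace norm. -/
theorem norm_apply_le_of_rep {F : Type*} [NormedAddCommGroup F] [Module ℂ F]
    (f : TraceClass H →ₗ[ℂ] F) {C : ℝ} (hC : 0 ≤ C)
    (hf : ∀ (T : TraceClass H) (x y : ℕ → H), IsNuclearRep T.toCLM x y →
      ‖f T‖ ≤ C * ∑' n, ‖x n‖ * ‖y n‖) (T : TraceClass H) : ‖f T‖ ≤ C * ‖T‖ := by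
  refine le_of_forall_pos_le_add fun ε hε => ?_
  obtain ⟨x, y, h, hlt⟩ := T.exists_rep_lt (r := ‖T‖ + ε / (C + 1))
    (lt_add_of_pos_right _ (by positivity))
  have h1 := hf T x y h
  have h2 : C * (ε / (C + 1)) ≤ ε := by
    rw [mul_div_assoc', div_le_iff₀ (by positivity)]
    nlinarith
  nlinarith [mul_le_mul_of_nonneg_left hlt.le hC]

section Complete

variable [CompleteSpace H]

/-- The trace class operator `∑ i, |x i⟩⟨y i|`. -/
theorem exists_of_summable {x y : ℕ → H} (h : Summable fun n => ‖x n‖ * ‖y n‖) :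
    ∃ T : TraceClass H, IsNuclearRep T.toCLM x y := by
  let f : ℕ → H →L[ℂ] H := fun n => InnerProductSpace.rankOne ℂ (x n) (y n)
  have hf : Summable f := Summable.of_norm (by simpa [f] using h)
  have hs : IsNuclearRep (∑' n, f n) x y := by
    refine ⟨h, fun z => ?_⟩
    simpa [f] using hf.hasSum.mapL (ContinuousLinearMap.apply ℂ H z)
  exact ⟨⟨_, x, y, hs⟩, hs⟩

/-- Concatenating nuclear representations of the terms of a series, one obtains its sum together
with a bound for the trace norm. The convergence is only asserted pointwise. -/
theorem exists_hasSum_of_norm_lt {v : ℕ → TraceClass H} {r : ℕ → ℝ} (hr : Summable r)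
    (hv : ∀ n, ‖v n‖ < r n) :
    ∃ T : TraceClass H, ‖T‖ ≤ ∑' n, r n ∧
      ∀ z, HasSum (fun n => (v n).toCLM z) (T.toCLM z) := by
  choose x y h hlt using fun n => (v n).exists_rep_lt (hv n)
  have hs : Summable fun p : ℕ × ℕ => ‖x p.1 p.2‖ * ‖y p.1 p.2‖ := by
    rw [summable_prod_of_nonneg fun _ => by positivity]
    exact ⟨fun n => (h n).summable,
      hr.of_nonneg_of_le (fun n => tsum_nonneg fun _ => by positivity) fun n => (hlt n).le⟩
  have hs' := Nat.pairEquiv.symm.summable_iff.mpr hs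
  obtain ⟨T, hT⟩ := exists_of_summable (x := fun n => x n.unpair.1 n.unpair.2)
    (y := fun n => y n.unpair.1 n.unpair.2) hs'
  refine ⟨T, (norm_le_of_rep hT).trans ?_, fun z => ?_⟩
  · have h1 := Nat.pairEquiv.symm.tsum_eq (fun p : ℕ × ℕ => ‖x p.1 p.2‖ * ‖y p.1 p.2‖)
    refine h1.le.trans ?_
    rw [hs.tsum_prod]
    exact (hs.prod).tsum_le_tsum (fun n => (hlt n).le) hr
  · have h1 : HasSum (fun p : ℕ × ℕ => ⟪y p.1 p.2, z⟫_ℂ • x p.1 p.2) (T.toCLM z) :=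
      (Nat.pairEquiv.symm.hasSum_iff
        (f := fun p : ℕ × ℕ => ⟪y p.1 p.2, z⟫_ℂ • x p.1 p.2)).mp (hT.hasSum z)
    exact h1.prod_fiberwise fun n => (h n).hasSum z

instance : CompleteSpace (TraceClass H) := by
  refine NormedAddCommGroup.completeSpace_of_summable_imp_tendsto fun v hv => ?_
  let r : ℕ → ℝ := fun n => ‖v n‖ + (1 / 2) ^ n
  have hr : Summable r := hv.add summable_geometric_two
  have hlt (n : ℕ) : ‖v n‖ < r n := lt_add_of_pos_right _ (by positivity)
  choose T hT hsum using fun N : ℕ =>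
    exists_hasSum_of_norm_lt ((summable_nat_add_iff N).mpr hr) fun n => hlt (n + N)
  refine ⟨T 0, ?_⟩
  -- `T N` is the sum of the tail from `N` on, so its trace norm bounds the error at `N`
  have hsub (N : ℕ) : T 0 - ∑ n ∈ Finset.range N, v n = T N := by
    refine toCLM_injective (ContinuousLinearMap.ext fun z => ?_)
    have h1 := (hasSum_nat_add_iff' N).mpr (hsum 0 z)
    simpa using h1.unique (hsum N z)
  rw [tendsto_iff_norm_sub_tendsto_zero]
  refine squeeze_zero (fun _ => norm_nonneg _) (fun N => ?_) (tendsto_sum_nat_add r)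
  rw [norm_sub_rev, hsub]
  exact hT N

end Complete

/-! ### Rank one operators and the trace -/

theorem isNuclearRep_rankOne (x y : H) :
    IsNuclearRep (InnerProductSpace.rankOne ℂ x y) (Pi.single 0 x) fun _ => y := by
  have h0 (n : ℕ) (hn : n ≠ 0) : (Pi.single 0 x : ℕ → H) n = 0 := by
    simp [hn]
  refine ⟨summable_of_ne_finset_zero (s := {0}) fun n hn => ?_, fun z => ?_⟩
  · rw [h0 n (by simpa using hn), norm_zero, zero_mul]
  · have h1 := hasSum_single (f := fun n => ⟪y, z⟫_ℂ • (Pi.single 0 x : ℕ → H) n) 0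
      fun n hn => by rw [h0 n hn, smul_zero]
    simpa using h1

/-- The rank one operator `|x⟩⟨y|` as a trace class operator. -/
def ketBra (x y : H) : TraceClass H :=
  ⟨InnerProductSpace.rankOne ℂ x y, _, _, isNuclearRep_rankOne x y⟩

@[simp]
theorem toCLM_ketBra (x y : H) : (ketBra x y).toCLM = InnerProductSpace.rankOne ℂ x y := rfl

theorem norm_ketBra_le (x y : H) : ‖ketBra x y‖ ≤ ‖x‖ * ‖y‖ := by
  refine (norm_le_of_rep (T := ketBra x y) (isNuclearRep_rankOne x y)).trans ?_
  rw [tsum_eq_single 0 fun n hn => by rw [Pi.single_eq_of_ne hn]; simp]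
  simp

variable [CompleteSpace H]

theorem hasSum_ketBra {T : TraceClass H} {x y : ℕ → H} (h : IsNuclearRep T.toCLM x y) :
    HasSum (fun n => ketBra (x n) (y n)) T := by
  have hs : Summable fun n => ketBra (x n) (y n) :=
    Summable.of_norm_bounded h.summable fun n => norm_ketBra_le _ _
  have hT : ∑' n, ketBra (x n) (y n) = T := by
    refine toCLM_injective (ContinuousLinearMap.ext fun z => ?_)
    have h1 := (hs.hasSum.mapL (toCLML H)).mapL (ContinuousLinearMap.apply ℂ H z)
    refine h1.unique ?_
    simpa using h.hasSum z
  exact hT ▸ hs.hasSum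

/-- Continuous linear maps on the trace class operators are determined by their values at the rank
one operators. -/
theorem ext_ketBra {F : Type*} [NormedAddCommGroup F] [NormedSpace ℂ F]
    {f g : TraceClass H →L[ℂ] F} (hfg : ∀ x y, f (ketBra x y) = g (ketBra x y)) : f = g := by
  ext T
  obtain ⟨x, y, h⟩ := T.exists_rep
  refine ((hasSum_ketBra h).mapL f).unique ?_
  simpa only [hfg] using (hasSum_ketBra h).mapL g

theorem trace_eq_of_rep {T : TraceClass H} {x y : ℕ → H} (h : IsNuclearRep T.toCLM x y) :
    T.trace = ∑' n, ⟪y n, x n⟫_ℂ :=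
  (hasSum_of_rep (exists_hilbertBasis ℂ H).choose_spec.choose h).tsum_eq

variable (H) in
/-- The trace as a continuous linear functional for the trace norm. -/
def traceCLM : TraceClass H →L[ℂ] ℂ :=
  LinearMap.mkContinuous
    { toFun := trace
      map_add' := fun S T => by
        obtain ⟨s, b, -⟩ := exists_hilbertBasis ℂ H
        refine (hasSum_trace b (S + T)).unique ?_
        simpa [inner_add_right] using (hasSum_trace b S).add (hasSum_trace b T)
      map_smul' := fun c T => by
        obtain ⟨s, b, -⟩ := exists_hilbertBasis ℂ H
        refine (hasSum_trace b (c • T)).unique ?_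
        simpa [inner_smul_right] using (hasSum_trace b T).mul_left c } 1 <| by
    refine norm_apply_le_of_rep _ zero_le_one fun T x y h => ?_
    change ‖T.trace‖ ≤ _
    rw [trace_eq_of_rep h, one_mul]
    exact tsum_of_norm_bounded h.summable.hasSum fun n => by
      rw [mul_comm]
      exact norm_inner_le_norm _ _

@[simp]
theorem traceCLM_apply (T : TraceClass H) : traceCLM H T = T.trace := rfl

@[simp]
theorem trace_ketBra (x y : H) : (ketBra x y).trace = ⟪y, x⟫_ℂ := by
  obtain ⟨s, b, -⟩ := exists_hilbertBasis ℂ H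
  refine (hasSum_trace b _).unique ?_
  simpa [inner_smul_right] using b.hasSum_inner_mul_inner y x

theorem conj_ketBra (X : H →L[ℂ] H) (x y : H) : conj X (ketBra x y) = ketBra (X x) (X y) := by
  refine toCLM_injective (ContinuousLinearMap.ext fun z => ?_)
  simp [ContinuousLinearMap.adjoint_inner_right]

theorem trace_nonneg {S : TraceClass H} (hS : S.toCLM.IsPositive) : 0 ≤ S.trace := by
  obtain ⟨s, b, -⟩ := exists_hilbertBasis ℂ H
  exact (hasSum_trace b S).nonneg fun i => hS.inner_nonneg_right _

/-- A unit vector `e` extends to a Hilbert basis, and `⟪e, S e⟫` is then one of the terms of the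
trace. -/
theorem inner_le_trace {S : TraceClass H} (hS : S.toCLM.IsPositive) (v : H) :
    ⟪v, S.toCLM v⟫_ℂ ≤ S.trace * (‖v‖ ^ 2 : ℝ) := by
  rcases eq_or_ne v 0 with rfl | hv
  · simp
  have hv' : ‖v‖ ≠ 0 := norm_ne_zero_iff.mpr hv
  let e : H := ((‖v‖⁻¹ : ℝ) : ℂ) • v
  have he : Orthonormal ℂ ((↑) : ({e} : Set H) → H) := by
    refine ⟨fun i => ?_, fun i j hij => (hij (Subsingleton.elim i j)).elim⟩
    rw [i.2, norm_smul, Complex.norm_real, norm_inv, norm_norm, inv_mul_cancel₀ hv']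
  obtain ⟨s, b, hs, hb⟩ := he.exists_hilbertBasis_extension
  have h1 := le_hasSum (hasSum_trace b S) ⟨e, hs rfl⟩ fun i _ => hS.inner_nonneg_right _
  rw [hb] at h1
  have hve : v = (‖v‖ : ℂ) • e := by
    simp [e, smul_smul, hv]
  have h2 : ⟪v, S.toCLM v⟫_ℂ = ⟪e, S.toCLM e⟫_ℂ * (‖v‖ ^ 2 : ℝ) := by
    conv_lhs => rw [hve]
    simp only [map_smul, inner_smul_left, inner_smul_right, Complex.conj_ofReal]
    push_cast
    ring
  rw [h2]
  exact mul_le_mul_of_nonneg_right h1 (by exact_mod_cast sq_nonneg ‖v‖)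

theorem eq_zero_of_trace_eq_zero {S : TraceClass H} (hS : S.toCLM.IsPositive)
    (h0 : S.trace = 0) : S = 0 := by
  refine toCLM_injective ?_
  rw [map_zero, ← ContinuousLinearMap.coe_inj]
  refine (ext_inner_map _ _).mp fun v => ?_
  have h1 := inner_le_trace hS v
  rw [h0, zero_mul] at h1
  have h2 := le_antisymm h1 (hS.inner_nonneg_right v)
  rw [← inner_conj_symm]
  simp [h2]

end TraceClass

/-! ### Kraus sums of subnormalized families -/

section KrausSum

variable {ι : Type*} {X : ι → H →L[ℂ] H}

/-- The condition `∑ j, (X j)* (X j) ≤ I`, expressed by finite partial sums. -/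
def IsSubnormalized (X : ι → H →L[ℂ] H) : Prop :=
  ∀ (s : Finset ι) (v : H), ∑ j ∈ s, ‖X j v‖ ^ 2 ≤ ‖v‖ ^ 2

theorem IsSubnormalized.comp_injective {κ : Type*} (hX : IsSubnormalized X) {e : κ → ι}
    (he : Function.Injective e) : IsSubnormalized (X ∘ e) := fun s v => by
  simpa using hX (s.map ⟨e, he⟩) v

theorem IsSubnormalized.of_hasSum (hX : ∀ v, ∃ r ≤ ‖v‖ ^ 2, HasSum (fun j => ‖X j v‖ ^ 2) r) :
    IsSubnormalized X := fun s v => by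
  obtain ⟨r, hr, h⟩ := hX v
  exact (sum_le_hasSum s (fun _ _ => by positivity) h).trans hr

theorem hasSum_inner_toCLM {f : ι → TraceClass H} {T : TraceClass H} (h : HasSum f T) (v w : H) :
    HasSum (fun j => ⟪v, (f j).toCLM w⟫_ℂ) ⟪v, T.toCLM w⟫_ℂ := by
  simpa using
    ((h.mapL (TraceClass.toCLML H)).mapL (ContinuousLinearMap.apply ℂ H w)).mapL (innerSL ℂ v)

variable [CompleteSpace H]

theorem IsNormalized.hasSum_inner (hX : IsNormalized X) (v w : H) :
    HasSum (fun j => ⟪X j v, X j w⟫_ℂ) ⟪v, w⟫_ℂ := by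
  simpa [ContinuousLinearMap.adjoint_inner_right] using (hX w).mapL (innerSL ℂ v)

theorem IsNormalized.hasSum_norm_sq (hX : IsNormalized X) (v : H) :
    HasSum (fun j => ‖X j v‖ ^ 2) (‖v‖ ^ 2) := by
  have h := (hX.hasSum_inner v v).mapL Complex.reCLM
  simp only [inner_self_eq_norm_sq_to_K] at h
  convert! h using 1
  · ext j
    simp [← Complex.ofReal_pow]
  · simp [← Complex.ofReal_pow]

theorem IsNormalized.isSubnormalized (hX : IsNormalized X) : IsSubnormalized X :=
  .of_hasSum fun v => ⟨_, le_rfl, hX.hasSum_norm_sq v⟩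

/-- For `T = ∑ n, |x n⟩⟨y n|`, the Cauchy-Schwarz inequality in `j` bounds
`∑ j, ‖X j (x n)‖ * ‖X j (y n)‖` by `‖x n‖ * ‖y n‖`. -/
theorem IsSubnormalized.sum_norm_conj_le (hX : IsSubnormalized X) (s : Finset ι)
    (T : TraceClass H) : ∑ j ∈ s, ‖TraceClass.conj (X j) T‖ ≤ ‖T‖ := by
  refine le_of_forall_pos_le_add fun ε hε => ?_
  obtain ⟨x, y, h, hlt⟩ := T.exists_rep_lt (r := ‖T‖ + ε) (lt_add_of_pos_right _ hε)
  have hbound (n : ℕ) : ∑ j ∈ s, ‖X j (x n)‖ * ‖X j (y n)‖ ≤ ‖x n‖ * ‖y n‖ := by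
    refine (Real.sum_mul_le_sqrt_mul_sqrt _ _ _).trans ?_
    refine mul_le_mul ?_ ?_ (Real.sqrt_nonneg _) (norm_nonneg _) <;>
    exact Real.sqrt_le_iff.mpr ⟨norm_nonneg _, hX s _⟩
  have hrep (j : ι) (hj : j ∈ s) :
      IsNuclearRep (TraceClass.conj (X j) T).toCLM (fun n => X j (x n)) (fun n => X j (y n)) := by
    refine ⟨h.summable.of_nonneg_of_le (fun n => by positivity) fun n => ?_, fun z => ?_⟩
    · exact (Finset.single_le_sum (f := fun j => ‖X j (x n)‖ * ‖X j (y n)‖)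
        (fun j _ => by positivity) hj).trans (hbound n)
    · simpa [ContinuousLinearMap.adjoint_inner_right] using
        (h.hasSum ((X j).adjoint z)).mapL (X j)
  calc ∑ j ∈ s, ‖TraceClass.conj (X j) T‖
      ≤ ∑ j ∈ s, ∑' n, ‖X j (x n)‖ * ‖X j (y n)‖ :=
        Finset.sum_le_sum fun j hj => TraceClass.norm_le_of_rep (hrep j hj)
    _ = ∑' n, ∑ j ∈ s, ‖X j (x n)‖ * ‖X j (y n)‖ :=
        (Summable.tsum_finsetSum fun j hj => (hrep j hj).summable).symm
    _ ≤ ∑' n, ‖x n‖ * ‖y n‖ :=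
        (summable_sum fun j hj => (hrep j hj).summable).tsum_le_tsum hbound h.summable
    _ ≤ ‖T‖ + ε := hlt.le

theorem IsSubnormalized.summable_norm_conj (hX : IsSubnormalized X) (T : TraceClass H) :
    Summable fun j => ‖TraceClass.conj (X j) T‖ :=
  summable_of_sum_le (fun _ => norm_nonneg _) fun s => hX.sum_norm_conj_le s T

theorem IsSubnormalized.summable_conj (hX : IsSubnormalized X) (T : TraceClass H) :
    Summable fun j => TraceClass.conj (X j) T :=
  (hX.summable_norm_conj T).of_norm

/-- The map `T ↦ ∑ j, X j T (X j)*`, for a family with `∑ j, (X j)* (X j) ≤ I`. The hypothesis makes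
the series absolutely convergent in trace norm. -/
def krausMap (X : ι → H →L[ℂ] H) (hX : IsSubnormalized X) : TraceClass H →L[ℂ] TraceClass H :=
  LinearMap.mkContinuous
    { toFun := fun T => ∑' j, TraceClass.conj (X j) T
      map_add' := fun S T => by
        simp only [map_add]
        exact (hX.summable_conj S).tsum_add (hX.summable_conj T)
      map_smul' := fun c T => by
        simp only [map_smul, RingHom.id_apply]
        exact (hX.summable_conj T).tsum_const_smul c } 1 fun T => by
    rw [one_mul]
    exact (norm_tsum_le_tsum_norm (hX.summable_norm_conj T)).trans
      ((hX.summable_norm_conj T).tsum_le_of_sum_le fun s => hX.sum_norm_conj_le s T)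

theorem hasSum_krausMap (hX : IsSubnormalized X) (T : TraceClass H) :
    HasSum (fun j => TraceClass.conj (X j) T) (krausMap X hX T) :=
  (hX.summable_conj T).hasSum

theorem isKrausSum_krausMap (hX : IsSubnormalized X) : IsKrausSum (krausMap X hX).toLinearMap X :=
  hasSum_krausMap hX

theorem IsKrausSum.unique {Φ Ψ : TraceClass H →ₗ[ℂ] TraceClass H} (hΦ : IsKrausSum Φ X)
    (hΨ : IsKrausSum Ψ X) : Φ = Ψ :=
  LinearMap.ext fun T => (hΦ T).unique (hΨ T)

theorem IsKrausSum.isCompletelyPositive {Φ : TraceClass H →ₗ[ℂ] TraceClass H}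
    (h : IsKrausSum Φ X) : IsCompletelyPositive Φ := by
  intro n T hT v
  have h1 : HasSum (fun k => ∑ i, ∑ j, ⟪v i, (TraceClass.conj (X k) (T i j)).toCLM (v j)⟫_ℂ)
      (∑ i, ∑ j, ⟪v i, (Φ (T i j)).toCLM (v j)⟫_ℂ) :=
    hasSum_sum fun i _ => hasSum_sum fun j _ => hasSum_inner_toCLM (h (T i j)) _ _
  refine h1.nonneg fun k => ?_
  simpa [ContinuousLinearMap.adjoint_inner_left] using hT fun i => (X k).adjoint (v i)

theorem isPositive_toCLM_conj (Y : H →L[ℂ] H) {ρ : TraceClass H} (hρ : ρ.toCLM.IsPositive) :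
    (TraceClass.conj Y ρ).toCLM.IsPositive :=
  hρ.conj_adjoint Y

theorem IsNormalized.trace_krausMap (hX : IsNormalized X) (T : TraceClass H) :
    (krausMap X hX.isSubnormalized T).trace = T.trace := by
  have h : (TraceClass.traceCLM H).comp (krausMap X hX.isSubnormalized) =
      TraceClass.traceCLM H := by
    refine TraceClass.ext_ketBra fun x y => ?_
    have h1 := (hasSum_krausMap hX.isSubnormalized (TraceClass.ketBra x y)).mapL
      (TraceClass.traceCLM H)
    refine h1.unique ?_
    simpa [TraceClass.conj_ketBra] using hX.hasSum_inner y x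
  exact congrArg (· T) h

theorem isOperation_of_isKrausSum_subtype {Φ : TraceClass H →ₗ[ℂ] TraceClass H}
    (hX : IsNormalized X) {A : Set ι} (h : IsKrausSum Φ fun j : A => X j) : IsOperation Φ := by
  have htr (ρ : TraceClass H) : HasSum (fun j : A => (TraceClass.conj (X j) ρ).trace)
      (Φ ρ).trace := (h ρ).mapL (TraceClass.traceCLM H)
  have htot (ρ : TraceClass H) : HasSum (fun j => (TraceClass.conj (X j) ρ).trace) ρ.trace := by
    have h1 := (hasSum_krausMap hX.isSubnormalized ρ).mapL (TraceClass.traceCLM H)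
    rwa [TraceClass.traceCLM_apply, hX.trace_krausMap] at h1
  have hpos {ρ : TraceClass H} (hρ : IsState ρ) (j : ι) :
      0 ≤ (TraceClass.conj (X j) ρ).trace :=
    TraceClass.trace_nonneg (isPositive_toCLM_conj _ hρ.1)
  refine ⟨h.isCompletelyPositive, fun ρ hρ => (htr ρ).nonneg fun j => hpos hρ _, fun ρ hρ => ?_⟩
  rw [← hρ.2]
  exact hasSum_le_inj (fun j : A => (j : ι)) Subtype.val_injective (fun j _ => hpos hρ j)
    (fun _ => le_rfl) (htr ρ) (htot ρ)

/-- A normalized Kraus family defines an instrument on its discrete index set, whose value at `A` is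
the partial Kraus sum over `A`. The index set is lifted to the universe of the outcome spaces. -/
theorem coexistent_of_isKrausSum {J : Type} {X : J → H →L[ℂ] H} (hX : IsNormalized X)
    {Φ Ψ : TraceClass H →ₗ[ℂ] TraceClass H} {J₁ J₂ : Set J}
    (hΦ : IsKrausSum Φ fun j : J₁ => X j) (hΨ : IsKrausSum Ψ fun j : J₂ => X j) :
    Coexistent.{w} Φ Ψ := by
  let Y : ULift.{w} J → H →L[ℂ] H := fun j => X j.down
  have hY : IsNormalized Y := fun v =>
    (Equiv.ulift.hasSum_iff (f := fun j => (X j).adjoint (X j v))).mpr (hX v)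
  have hsub (A : Set (ULift.{w} J)) : IsSubnormalized fun j : A => Y j :=
    hY.isSubnormalized.comp_injective Subtype.val_injective
  have hK (A : Set (ULift.{w} J)) := isKrausSum_krausMap (hsub A)
  have hlift {Θ : TraceClass H →ₗ[ℂ] TraceClass H} {A : Set J}
      (hΘ : IsKrausSum Θ fun j : A => X j) :
      IsKrausSum Θ fun j : (ULift.down ⁻¹' A : Set (ULift.{w} J)) => Y j := fun T =>
    ((Equiv.ulift.subtypeEquiv fun _ => Iff.rfl :
      (ULift.down ⁻¹' A : Set (ULift.{w} J)) ≃ A).hasSum_iff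
        (f := fun j : A => TraceClass.conj (X j) T)).mpr (hΘ T)
  let _ : MeasurableSpace (ULift.{w} J) := ⊤
  refine ⟨ULift.{w} J, inferInstance, fun A => (krausMap (fun j : A => Y j) (hsub A)).toLinearMap,
    ⟨fun A _ => isOperation_of_isKrausSum_subtype hY (hK A), fun A _ hA T => ?_, fun ρ hρ => ?_⟩,
    ⟨ULift.down ⁻¹' J₁, MeasurableSpace.measurableSet_top,
      (hK (ULift.down ⁻¹' J₁)).unique (hlift hΦ)⟩,
    ⟨ULift.down ⁻¹' J₂, MeasurableSpace.measurableSet_top,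
      (hK (ULift.down ⁻¹' J₂)).unique (hlift hΨ)⟩⟩
  · have h1 := ((Set.unionEqSigmaOfDisjoint hA).symm.hasSum_iff
      (f := fun j : ⋃ n, A n => TraceClass.conj (Y j) T)).mpr (hK (⋃ n, A n) T)
    exact h1.sigma fun n => hK (A n) T
  · have h1 : krausMap (fun j : (Set.univ : Set (ULift.{w} J)) => Y j) (hsub Set.univ) =
        krausMap Y hY.isSubnormalized := by
      ext T
      exact (hasSum_krausMap (hsub Set.univ) T).unique
        ((Equiv.Set.univ _).hasSum_iff.mpr (hasSum_krausMap hY.isSubnormalized T))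
    change (krausMap _ (hsub Set.univ) ρ).trace = 1
    rw [h1, hY.trace_krausMap, hρ.2]

end KrausSum

/-! ### Positivity and weak continuity of operations -/

section Positivity

theorem isPositive_toCLM_of_rep {T : TraceClass H} {x : ℕ → H} (h : IsNuclearRep T.toCLM x x) :
    T.toCLM.IsPositive := by
  rw [ContinuousLinearMap.isPositive_iff_complex]
  intro v
  have h1 : HasSum (fun n => ((‖⟪v, x n⟫_ℂ‖ ^ 2 : ℝ) : ℂ)) ⟪T.toCLM v, v⟫_ℂ := by
    have h2 := ((h.hasSum v).mapL (innerSL ℂ v)).map (starRingEnd ℂ) Complex.continuous_conj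
    rw [innerSL_apply_apply, inner_conj_symm] at h2
    convert! h2 using 2 with n
    simp [← Complex.mul_conj']
  have h3 : 0 ≤ ⟪T.toCLM v, v⟫_ℂ := h1.nonneg fun n => by exact_mod_cast sq_nonneg ‖⟪v, x n⟫_ℂ‖
  exact ⟨(Complex.eq_re_of_ofReal_le h3).symm, (Complex.nonneg_iff.mp h3).1⟩

/-- Rescaling the two vectors of each term of a nuclear representation to equal norms. -/
theorem IsNuclearRep.exists_balanced {T : H →L[ℂ] H} {x y : ℕ → H} (h : IsNuclearRep T x y) :
    ∃ x' y' : ℕ → H, IsNuclearRep T x' y' ∧ (∀ n, ‖x' n‖ ^ 2 = ‖x n‖ * ‖y n‖) ∧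
      ∀ n, ‖y' n‖ ^ 2 = ‖x n‖ * ‖y n‖ := by
  have key (a b : H) : ∃ a' b' : H, ‖a'‖ ^ 2 = ‖a‖ * ‖b‖ ∧ ‖b'‖ ^ 2 = ‖a‖ * ‖b‖ ∧
      ∀ z, ⟪b', z⟫_ℂ • a' = ⟪b, z⟫_ℂ • a := by
    rcases eq_or_ne a 0 with rfl | ha
    · exact ⟨0, 0, by simp⟩
    rcases eq_or_ne b 0 with rfl | hb
    · exact ⟨0, 0, by simp⟩
    have ha' : 0 < ‖a‖ := norm_pos_iff.mpr ha
    have hb' : 0 < ‖b‖ := norm_pos_iff.mpr hb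
    let c : ℝ := √(‖b‖ / ‖a‖)
    have hc : c ^ 2 = ‖b‖ / ‖a‖ := Real.sq_sqrt (by positivity)
    have hc0 : c ≠ 0 := (Real.sqrt_pos.mpr (by positivity)).ne'
    refine ⟨(c : ℂ) • a, ((c⁻¹ : ℝ) : ℂ) • b, ?_, ?_, fun z => ?_⟩
    · rw [norm_smul, mul_pow, Complex.norm_real, Real.norm_eq_abs, sq_abs, hc]
      field_simp
    · rw [norm_smul, mul_pow, Complex.norm_real, Real.norm_eq_abs, sq_abs, inv_pow, hc]
      field_simp
    · rw [inner_smul_left, Complex.conj_ofReal, smul_smul]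
      congr 1
      push_cast
      field_simp
  choose a b ha hb hab using fun n => key (x n) (y n)
  refine ⟨a, b, ⟨h.summable.congr fun n => ?_, fun z => ?_⟩, ha, hb⟩
  · have h1 : (‖a n‖ * ‖b n‖) ^ 2 = (‖x n‖ * ‖y n‖) ^ 2 := by rw [mul_pow, ha, hb, sq]
    exact ((sq_eq_sq₀ (by positivity) (by positivity)).mp h1).symm
  · simpa only [hab] using h.hasSum z

variable {Φ : TraceClass H →ₗ[ℂ] TraceClass H}

theorem IsCompletelyPositive.isPositive (hΦ : IsCompletelyPositive Φ) {S : TraceClass H}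
    (hS : S.toCLM.IsPositive) : (Φ S).toCLM.IsPositive := by
  have h0 (v : H) : 0 ≤ ⟪v, (Φ S).toCLM v⟫_ℂ := by
    have h1 := hΦ 1 (fun _ _ => S) (fun v => by simpa using hS.inner_nonneg_right (v 0))
      fun _ => v
    simpa using h1
  rw [ContinuousLinearMap.isPositive_iff_complex]
  intro v
  have h1 : 0 ≤ ⟪(Φ S).toCLM v, v⟫_ℂ := by
    rw [← inner_conj_symm]
    exact star_nonneg_iff.mpr (h0 v)
  exact ⟨(Complex.eq_re_of_ofReal_le h1).symm, (Complex.nonneg_iff.mp h1).1⟩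

variable [CompleteSpace H]

/-- A positive trace class operator is a multiple of a state. -/
theorem exists_isState_smul_eq {S : TraceClass H} (hS : S.toCLM.IsPositive) :
    S = 0 ∨ ∃ ρ, IsState ρ ∧ S.trace • ρ = S := by
  rcases eq_or_ne S.trace 0 with h | h
  · exact .inl (TraceClass.eq_zero_of_trace_eq_zero hS h)
  refine .inr ⟨S.trace⁻¹ • S, ⟨?_, ?_⟩, smul_inv_smul₀ h S⟩
  · rw [map_smul]
    exact hS.smul_of_nonneg (inv_nonneg.mpr (TraceClass.trace_nonneg hS))
  · rw [← TraceClass.traceCLM_apply, map_smul, TraceClass.traceCLM_apply, smul_eq_mul,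
      inv_mul_cancel₀ h]

theorem trace_map_smul (c : ℂ) (S : TraceClass H) :
    (Φ (c • S)).trace = c * (Φ S).trace := by
  rw [map_smul, ← TraceClass.traceCLM_apply, map_smul, TraceClass.traceCLM_apply, smul_eq_mul]

theorem IsOperation.trace_le (hΦ : IsOperation Φ) {S : TraceClass H}
    (hS : S.toCLM.IsPositive) : (Φ S).trace ≤ S.trace := by
  rcases exists_isState_smul_eq hS with rfl | ⟨ρ, hρ, h⟩
  · rw [map_zero]
  · calc (Φ S).trace = S.trace * (Φ ρ).trace := by
          conv_lhs => rw [← h]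
          exact trace_map_smul _ _
      _ ≤ S.trace * 1 :=
          mul_le_mul_of_nonneg_left (hΦ.trace_le_one ρ hρ) (TraceClass.trace_nonneg hS)
      _ = S.trace := mul_one _

/-- For balanced `x` and `y`, polarization writes `4 * ∑ n, |x n⟩⟨y n|` as a combination with
coefficients `I ^ k` of the positive operators `∑ n, |x n + I ^ k • y n⟩⟨x n + I ^ k • y n|`, whose
traces are at most `4 * ∑ n, ‖x n‖ * ‖y n‖`. -/
theorem IsOperation.norm_inner_le_of_rep (hΦ : IsOperation Φ) (v : H) {T : TraceClass H}
    {x y : ℕ → H} (h : IsNuclearRep T.toCLM x y) :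
    ‖⟪v, (Φ T).toCLM v⟫_ℂ‖ ≤ 4 * ‖v‖ ^ 2 * ∑' n, ‖x n‖ * ‖y n‖ := by
  obtain ⟨a, b, hab, ha, hb⟩ := h.exists_balanced
  let z (k : Fin 4) (n : ℕ) : H := a n + Complex.I ^ (k : ℕ) • b n
  have hz (k : Fin 4) (n : ℕ) : ‖z k n‖ * ‖z k n‖ ≤ 4 * (‖x n‖ * ‖y n‖) := by
    have h1 : ‖z k n‖ ≤ ‖a n‖ + ‖b n‖ := by
      refine (norm_add_le _ _).trans_eq ?_
      rw [norm_smul, norm_pow, Complex.norm_I, one_pow, one_mul]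
    nlinarith [ha n, hb n, norm_nonneg (z k n), sq_nonneg (‖a n‖ - ‖b n‖)]
  have hzs (k : Fin 4) : Summable fun n => ‖z k n‖ * ‖z k n‖ :=
    (h.summable.mul_left 4).of_nonneg_of_le (fun n => by positivity) (hz k)
  choose P hP using fun k => TraceClass.exists_of_summable (hzs k)
  have hPpos (k : Fin 4) : (P k).toCLM.IsPositive := isPositive_toCLM_of_rep (hP k)
  have htr (k : Fin 4) : (P k).trace ≤ ((4 * ∑' n, ‖x n‖ * ‖y n‖ : ℝ) : ℂ) := by
    rw [TraceClass.trace_eq_of_rep (hP k)]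
    have h1 : ∑' n, ⟪z k n, z k n⟫_ℂ = ((∑' n, ‖z k n‖ * ‖z k n‖ : ℝ) : ℂ) := by
      rw [Complex.ofReal_tsum]
      exact tsum_congr fun n => by
        rw [inner_self_eq_norm_sq_to_K, sq, Complex.ofReal_mul]
        rfl
    rw [h1, Complex.real_le_real, ← tsum_mul_left]
    exact (hzs k).tsum_le_tsum (hz k) (h.summable.mul_left 4)
  have hnorm (k : Fin 4) :
      ‖⟪v, (Φ (P k)).toCLM v⟫_ℂ‖ ≤ 4 * (∑' n, ‖x n‖ * ‖y n‖) * ‖v‖ ^ 2 := by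
    have hpos := hΦ.completelyPositive.isPositive (hPpos k)
    have h1 : ⟪v, (Φ (P k)).toCLM v⟫_ℂ ≤ ((4 * (∑' n, ‖x n‖ * ‖y n‖) * ‖v‖ ^ 2 : ℝ) : ℂ) := by
      refine (TraceClass.inner_le_trace hpos v).trans ?_
      rw [Complex.ofReal_mul]
      exact mul_le_mul_of_nonneg_right ((hΦ.trace_le (hPpos k)).trans (htr k))
        (by exact_mod_cast sq_nonneg ‖v‖)
    have h2 := CStarAlgebra.norm_le_norm_of_nonneg_of_le (hpos.inner_nonneg_right v) h1
    refine h2.trans_eq ?_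
    rw [Complex.norm_real, Real.norm_of_nonneg]
    exact mul_nonneg (mul_nonneg zero_le_four (IsNuclearRep.tsum_nonneg x y)) (sq_nonneg _)
  have hT : (4 : ℂ) • T = ∑ k : Fin 4, Complex.I ^ (k : ℕ) • P k := by
    refine TraceClass.toCLM_injective (ContinuousLinearMap.ext fun w => ?_)
    simp only [map_smul, map_sum, _root_.sum_apply, _root_.smul_apply]
    refine ((hab.hasSum w).const_smul (4 : ℂ)).unique ?_
    convert! hasSum_sum (s := Finset.univ) fun (k : Fin 4) _ =>
      ((hP k).hasSum w).const_smul (Complex.I ^ (k : ℕ)) using 2 with n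
    -- the coefficient of `|a n⟩⟨b n|` is `4`, and the other three cancel
    simp only [z, Fin.sum_univ_four, inner_add_left, inner_smul_left, smul_add, smul_smul]
    simp only [Fin.coe_ofNat_eq_mod, map_pow, Complex.conj_I]
    match_scalars <;> norm_num [pow_succ, mul_assoc] <;> ring_nf <;> simp <;> ring
  have h4 : 4 * ⟪v, (Φ T).toCLM v⟫_ℂ =
      ∑ k : Fin 4, Complex.I ^ (k : ℕ) * ⟪v, (Φ (P k)).toCLM v⟫_ℂ := by
    have h1 := congrArg (fun S => ⟪v, (Φ S).toCLM v⟫_ℂ) hT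
    simpa [inner_smul_right, inner_sum] using h1
  have h5 : 4 * ‖⟪v, (Φ T).toCLM v⟫_ℂ‖ ≤
      ∑ _k : Fin 4, 4 * (∑' n, ‖x n‖ * ‖y n‖) * ‖v‖ ^ 2 := by
    calc 4 * ‖⟪v, (Φ T).toCLM v⟫_ℂ‖ = ‖4 * ⟪v, (Φ T).toCLM v⟫_ℂ‖ := by simp
      _ ≤ ∑ k : Fin 4, ‖Complex.I ^ (k : ℕ) * ⟪v, (Φ (P k)).toCLM v⟫_ℂ‖ := by
          rw [h4]
          exact norm_sum_le _ _
      _ ≤ _ := Finset.sum_le_sum fun k _ => by simpa using hnorm k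
  rw [Finset.sum_const, Finset.card_univ, Fintype.card_fin, nsmul_eq_mul, Nat.cast_ofNat] at h5
  linarith

/-- The functional `T ↦ ⟪v, Φ T v⟫` is continuous for the trace norm. -/
def IsOperation.innerCLM (hΦ : IsOperation Φ) (v : H) : TraceClass H →L[ℂ] ℂ :=
  ((innerSL ℂ v).comp (ContinuousLinearMap.apply ℂ H v)).toLinearMap.comp
    (TraceClass.toCLM.comp Φ) |>.mkContinuous (4 * ‖v‖ ^ 2)
    (TraceClass.norm_apply_le_of_rep _ (by positivity) fun _ _ _ h =>
      hΦ.norm_inner_le_of_rep v h)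

theorem IsOperation.innerCLM_apply (hΦ : IsOperation Φ) (v : H) (T : TraceClass H) :
    hΦ.innerCLM v T = ⟪v, (Φ T).toCLM v⟫_ℂ := rfl

/-- A Kraus decomposition has to be checked only at the rank one operators, and only weakly: both
sides are weakly continuous in `T`, and the Kraus sum converges in trace norm anyway. -/
theorem IsOperation.isKrausSum_of_ketBra {ι : Type*} {X : ι → H →L[ℂ] H} (hΦ : IsOperation Φ)
    (hX : IsSubnormalized X)
    (h : ∀ x y v, HasSum (fun j => ⟪v, X j x⟫_ℂ * ⟪X j y, v⟫_ℂ)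
      ⟪v, (Φ (TraceClass.ketBra x y)).toCLM v⟫_ℂ) : IsKrausSum Φ X := by
  have key (T : TraceClass H) : Φ T = krausMap X hX T := by
    refine TraceClass.toCLM_injective ?_
    rw [← ContinuousLinearMap.coe_inj]
    refine (ext_inner_map _ _).mp fun v => ?_
    have h1 : hΦ.innerCLM v = ((innerSL ℂ v).comp (ContinuousLinearMap.apply ℂ H v)).comp
        ((TraceClass.toCLML H).comp (krausMap X hX)) := by
      refine TraceClass.ext_ketBra fun x y => ?_
      refine HasSum.unique (h x y v) ?_
      have h2 := hasSum_inner_toCLM (hasSum_krausMap hX (TraceClass.ketBra x y)) v v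
      simpa [TraceClass.conj_ketBra, inner_smul_right, mul_comm] using h2
    have h2 := congrArg (starRingEnd ℂ) (DFunLike.congr_fun h1 T)
    rw [hΦ.innerCLM_apply, inner_conj_symm] at h2
    refine h2.trans ?_
    exact inner_conj_symm _ _
  intro T
  rw [key]
  exact hasSum_krausMap hX T

end Positivity

/-! ### Kraus decompositions from reproducing kernels -/

section Kernel

theorem TraceClass.ketBra_add_right (x y y' : H) : ketBra x (y + y') = ketBra x y + ketBra x y' :=
  toCLM_injective <| by simp

theorem TraceClass.ketBra_smul_right (c : ℂ) (x y : H) :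
    ketBra x (c • y) = starRingEnd ℂ c • ketBra x y :=
  toCLM_injective <| by simp

theorem isPositive_toCLM_ketBra (x : H) : (TraceClass.ketBra x x).toCLM.IsPositive :=
  InnerProductSpace.isPositive_rankOne_self x

theorem isPosBlock_ketBra {n : ℕ} (x : Fin n → H) :
    IsPosBlock fun i j => TraceClass.ketBra (x i) (x j) := fun v => by
  have h : ∑ i, ∑ j, ⟪v i, (TraceClass.ketBra (x i) (x j)).toCLM (v j)⟫_ℂ =
      (∑ i, ⟪v i, x i⟫_ℂ) * star (∑ i, ⟪v i, x i⟫_ℂ) := by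
    rw [star_sum, Finset.sum_mul_sum]
    simp [mul_comm]
  rw [h]
  exact mul_star_self_nonneg _

variable {Φ : TraceClass H →ₗ[ℂ] TraceClass H}

/-- The operator valued kernel `(x, y) ↦ Φ |x⟩⟨y|` on `H`, a basis free form of the Choi matrix
of `Φ`. -/
def choiKernel (Φ : TraceClass H →ₗ[ℂ] TraceClass H) : Matrix H H (H →L[ℂ] H) :=
  .of fun x y => (Φ (TraceClass.ketBra x y)).toCLM

theorem choiKernel_apply (x y : H) : choiKernel Φ x y = (Φ (TraceClass.ketBra x y)).toCLM := rfl

variable [CompleteSpace H]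

theorem IsCompletelyPositive.isHermitian_choiKernel (hΦ : IsCompletelyPositive Φ) :
    (choiKernel Φ).IsHermitian := by
  ext x y v
  refine ext_inner_left ℂ fun u => ?_
  have hdiag (z w : H) : (⟪w, choiKernel Φ z z w⟫_ℂ).im = 0 := by
    have h1 := hΦ 1 _ (isPosBlock_ketBra ![z]) ![w]
    simp only [Fin.sum_univ_one, Matrix.cons_val_zero] at h1
    exact (Complex.nonneg_iff.mp h1).2.symm
  have hoff (w : H) :
      (⟪u, choiKernel Φ x y w⟫_ℂ).im + (⟪w, choiKernel Φ y x u⟫_ℂ).im = 0 := by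
    have h1 := hΦ 2 _ (isPosBlock_ketBra ![x, y]) ![u, w]
    simp only [Fin.sum_univ_two, Matrix.cons_val_zero, Matrix.cons_val_one] at h1
    have h2 := (Complex.nonneg_iff.mp h1).2.symm
    have h3 := hdiag x u
    have h4 := hdiag y w
    simp only [choiKernel_apply, Complex.add_im] at h2 h3 h4 ⊢
    linarith
  rw [Matrix.conjTranspose_apply, ContinuousLinearMap.star_eq_adjoint,
    ContinuousLinearMap.adjoint_inner_right, ← inner_conj_symm]
  have h1 := hoff v
  -- `h1` compares the imaginary parts, the same identity for `I • v` the real parts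
  have h2 := hoff (Complex.I • v)
  simp only [map_smul, inner_smul_left, inner_smul_right, Complex.conj_I, neg_mul,
    Complex.neg_im, Complex.mul_im, Complex.I_re, Complex.I_im] at h2
  apply Complex.ext <;> simp only [Complex.conj_re, Complex.conj_im] <;> linarith

/-- The block `(|x i⟩⟨x j|)` is positive, and complete positivity of `Φ` at these blocks is the
positivity of the kernel. -/
theorem IsCompletelyPositive.posSemidef_choiKernel (hΦ : IsCompletelyPositive Φ) :
    (choiKernel Φ).PosSemidef := by
  have htfae := (RKHS.posSemidef_tfae (K := choiKernel Φ)).out 0 2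
  refine htfae.mpr ⟨hΦ.isHermitian_choiKernel, fun f => ?_⟩
  let e := f.support.equivFin.symm
  have h1 := hΦ _ _ (isPosBlock_ketBra fun i => (e i : H)) fun i => f (e i)
  have h2 : (f.sum fun x v => f.sum fun x' v' => ⟪choiKernel Φ x' x v, v'⟫_ℂ) =
      star (∑ i, ∑ j, ⟪f (e i), (Φ (TraceClass.ketBra (e i : H) (e j))).toCLM (f (e j))⟫_ℂ) := by
    simp only [Finsupp.sum]
    rw [Finset.sum_comm, ← Finset.sum_coe_sort, ← e.sum_comp, star_sum]
    refine Finset.sum_congr rfl fun i _ => ?_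
    rw [← Finset.sum_coe_sort, ← e.sum_comp, star_sum]
    exact Finset.sum_congr rfl fun j _ => (inner_conj_symm _ _).symm
  rw [h2]
  exact (Complex.nonneg_iff.mp (star_nonneg_iff.mpr h1)).1

section ReproducingKernel

variable {E : Type*} [NormedAddCommGroup E] [InnerProductSpace ℂ E] [CompleteSpace E]
  [RKHS ℂ E H H]

theorem inner_kerFun_kerFun (hK : RKHS.kernel E = choiKernel Φ) (x y v w : H) :
    ⟪RKHS.kerFun E x v, RKHS.kerFun E y w⟫_ℂ =
      ⟪v, (Φ (TraceClass.ketBra x y)).toCLM w⟫_ℂ := by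
  rw [RKHS.kerFun_inner, RKHS.kerFun_apply, hK, choiKernel_apply]

theorem norm_kerFun_le (hΦ : IsOperation Φ) (hK : RKHS.kernel E = choiKernel Φ) (x : H) :
    ‖RKHS.kerFun E x‖ ≤ ‖x‖ := by
  refine ContinuousLinearMap.opNorm_le_bound _ (norm_nonneg x) fun v => ?_
  have hpos := isPositive_toCLM_ketBra x
  have h1 := (TraceClass.inner_le_trace (hΦ.completelyPositive.isPositive hpos) v).trans
    (mul_le_mul_of_nonneg_right (hΦ.trace_le hpos) (by exact_mod_cast sq_nonneg ‖v‖))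
  rw [← inner_kerFun_kerFun hK, inner_self_eq_ofReal, TraceClass.trace_ketBra,
    inner_self_eq_ofReal] at h1
  have h2 : ‖RKHS.kerFun E x v‖ ^ 2 ≤ ‖x‖ ^ 2 * ‖v‖ ^ 2 := by
    exact_mod_cast h1
  rw [← mul_pow] at h2
  exact (sq_le_sq₀ (norm_nonneg _) (by positivity)).mp h2

/-- The elements of the Hilbert space with reproducing kernel `(x, y) ↦ Φ |x⟩⟨y|` are bounded
linear maps, as functions on `H`. -/
def evalCLM (hΦ : IsOperation Φ) (hK : RKHS.kernel E = choiKernel Φ) (f : E) : H →L[ℂ] H :=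
  LinearMap.mkContinuous
    { toFun := f
      map_add' := fun x y => ext_inner_left ℂ fun v => by
        have h : RKHS.kerFun E (x + y) v = RKHS.kerFun E x v + RKHS.kerFun E y v :=
          RKHS.ext fun z => by
            simp [RKHS.kerFun_apply, hK, choiKernel_apply, TraceClass.ketBra_add_right]
        simp only [inner_add_right, ← RKHS.kerFun_inner, h, inner_add_left]
      map_smul' := fun c x => ext_inner_left ℂ fun v => by
        have h : RKHS.kerFun E (c • x) v = starRingEnd ℂ c • RKHS.kerFun E x v :=
          RKHS.ext fun z => by
            simp [RKHS.kerFun_apply, hK, choiKernel_apply, TraceClass.ketBra_smul_right]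
        simp only [inner_smul_right, ← RKHS.kerFun_inner, h, inner_smul_left, RingHom.id_apply,
          Complex.conj_conj] } ‖f‖ fun x => by
    change ‖f x‖ ≤ _
    rw [← RKHS.adjoint_kerFun, mul_comm]
    refine (ContinuousLinearMap.le_opNorm _ _).trans ?_
    rw [LinearIsometryEquiv.norm_map]
    exact mul_le_mul_of_nonneg_right (norm_kerFun_le hΦ hK x) (norm_nonneg f)

theorem evalCLM_apply (hΦ : IsOperation Φ) (hK : RKHS.kernel E = choiKernel Φ) (f : E) (x : H) :
    evalCLM hΦ hK f x = f x := rfl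

/-- By Parseval's identity in `H` and Bessel's inequality in `E`, the sum `∑ i, ‖b i x‖ ^ 2` is
bounded by `∑ a, ‖k_x (e a)‖ ^ 2 = tr (Φ |x⟩⟨x|)`, where `k_x` is the kernel function and `e` a
Hilbert basis of `H`. -/
theorem isSubnormalized_evalCLM (hΦ : IsOperation Φ) (hK : RKHS.kernel E = choiKernel Φ)
    {ι : Type*} {b : ι → E} (hb : Orthonormal ℂ b) :
    IsSubnormalized fun i => evalCLM hΦ hK (b i) := fun s x => by
  obtain ⟨w, e, -⟩ := exists_hilbertBasis ℂ H
  have hsq (v : H) : HasSum (fun a => ‖⟪e a, v⟫_ℂ‖ ^ 2) (‖v‖ ^ 2) := by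
    have h1 := (e.hasSum_inner_mul_inner v v).mapL Complex.reCLM
    simp only [inner_self_eq_norm_sq_to_K] at h1
    convert! h1 using 1
    · ext a
      rw [← inner_conj_symm v, Complex.conj_mul']
      simp [← Complex.ofReal_pow]
    · simp [← Complex.ofReal_pow]
  have hpos := isPositive_toCLM_ketBra x
  have htr : HasSum (fun a => ‖RKHS.kerFun E x (e a)‖ ^ 2)
      ((Φ (TraceClass.ketBra x x)).trace).re := by
    have h1 := (TraceClass.hasSum_trace e (Φ (TraceClass.ketBra x x))).mapL Complex.reCLM
    simp only [← inner_kerFun_kerFun hK, inner_self_eq_norm_sq_to_K] at h1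
    simpa [← Complex.ofReal_pow] using h1
  calc ∑ i ∈ s, ‖evalCLM hΦ hK (b i) x‖ ^ 2
      ≤ ((Φ (TraceClass.ketBra x x)).trace).re := by
        refine hasSum_le (fun a => ?_) (hasSum_sum fun i _ => hsq (evalCLM hΦ hK (b i) x)) htr
        simp only [evalCLM_apply, ← RKHS.kerFun_inner]
        exact (Finset.sum_congr rfl fun i _ => by rw [norm_inner_symm]).trans_le
          (hb.sum_inner_products_le _)
    _ ≤ ((TraceClass.ketBra x x).trace).re := (Complex.le_def.mp (hΦ.trace_le hpos)).1
    _ = ‖x‖ ^ 2 := by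
        rw [TraceClass.trace_ketBra]
        exact inner_self_eq_norm_sq (𝕜 := ℂ) x

theorem isKrausSum_evalCLM (hΦ : IsOperation Φ) (hK : RKHS.kernel E = choiKernel Φ)
    {ι : Type*} (b : HilbertBasis ι ℂ E) : IsKrausSum Φ fun i => evalCLM hΦ hK (b i) := by
  refine hΦ.isKrausSum_of_ketBra (isSubnormalized_evalCLM hΦ hK b.orthonormal) fun x y v => ?_
  rw [← inner_kerFun_kerFun hK]
  simpa [evalCLM_apply] using b.hasSum_inner_mul_inner (RKHS.kerFun E x v) (RKHS.kerFun E y v)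

/-- For each of countably many vectors `g`, only countably many `b i` satisfy `⟪b i, g⟫ ≠ 0`. With
kernel functions at a dense sequence as `g`, this exhausts the basis. -/
theorem countable_of_hilbertBasis [TopologicalSpace.SeparableSpace H] (hΦ : IsOperation Φ)
    (hK : RKHS.kernel E = choiKernel Φ) {ι : Type*} (b : HilbertBasis ι ℂ E) : Countable ι := by
  have hc (n m : ℕ) : {i | ⟪TopologicalSpace.denseSeq H m,
      evalCLM hΦ hK (b i) (TopologicalSpace.denseSeq H n)⟫_ℂ ≠ 0}.Countable := by
    let g := RKHS.kerFun E (TopologicalSpace.denseSeq H n) (TopologicalSpace.denseSeq H m)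
    refine ((b.hasSum_inner_mul_inner g g).summable.countable_support).mono fun i hi => ?_
    rw [Set.mem_ofPred_eq, evalCLM_apply, ← RKHS.kerFun_inner] at hi
    rw [Function.mem_support, ← inner_conj_symm (b i)]
    exact mul_ne_zero hi (star_ne_zero.mpr hi)
  rw [← Set.countable_univ_iff]
  refine (Set.countable_iUnion fun n => Set.countable_iUnion (hc n)).mono fun i _ => ?_
  by_contra hi
  simp only [Set.mem_iUnion, Set.mem_ofPred_eq, not_exists, not_not] at hi
  have h0 (n : ℕ) : evalCLM hΦ hK (b i) (TopologicalSpace.denseSeq H n) = 0 :=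
    (TopologicalSpace.denseRange_denseSeq H).eq_zero_of_inner_right ℂ (hi n)
  have h1 : ⇑(evalCLM hΦ hK (b i)) = 0 :=
    (TopologicalSpace.denseRange_denseSeq H).equalizer (evalCLM hΦ hK (b i)).continuous
      continuous_zero (funext h0)
  have h2 : b i = 0 := RKHS.ext fun x => by
    simpa [evalCLM_apply] using congrFun h1 x
  exact b.orthonormal.ne_zero i h2

/-- `E` is a space of linear maps from `H` to `H`. -/
theorem card_le_of_linearIndependent [FiniteDimensional ℂ H] (hΦ : IsOperation Φ)
    (hK : RKHS.kernel E = choiKernel Φ) {ι : Type*} {b : ι → E} (hb : LinearIndependent ℂ b) :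
    Finite ι ∧ Nat.card ι ≤ Module.finrank ℂ H ^ 2 := by
  let L : E →ₗ[ℂ] H →ₗ[ℂ] H :=
    { toFun := fun f => (evalCLM hΦ hK f).toLinearMap
      map_add' := fun f g => LinearMap.ext fun x => by simp [evalCLM_apply]
      map_smul' := fun c f => LinearMap.ext fun x => by simp [evalCLM_apply] }
  have hL : Function.Injective L := fun f g hfg => RKHS.ext fun x => LinearMap.congr_fun hfg x
  have hb' := hb.map' L (LinearMap.ker_eq_bot.mpr hL)
  have hfin := hb'.finite
  have := Fintype.ofFinite ι
  refine ⟨hfin, ?_⟩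
  rw [Nat.card_eq_fintype_card, sq, ← Module.finrank_linearMap]
  exact hb'.fintype_card_le_finrank

end ReproducingKernel

/-- Kraus' theorem. The Kraus operators are the vectors of a Hilbert basis of the Hilbert space with
reproducing kernel `(x, y) ↦ Φ |x⟩⟨y|`. -/
theorem IsOperation.exists_isKrausSum [TopologicalSpace.SeparableSpace H] (hΦ : IsOperation Φ) :
    ∃ (ι : Type) (_ : Countable ι) (X : ι → H →L[ℂ] H), IsKrausSum Φ X ∧
      (FiniteDimensional ℂ H → Finite ι ∧ Nat.card ι ≤ Module.finrank ℂ H ^ 2) := by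
  have : Fact (choiKernel Φ).PosSemidef := ⟨hΦ.completelyPositive.posSemidef_choiKernel⟩
  have hK : RKHS.kernel (RKHS.OfKernel (choiKernel Φ)) = choiKernel Φ :=
    RKHS.OfKernel.kernel_ofKernel
  obtain ⟨w, b, -⟩ := exists_hilbertBasis ℂ (RKHS.OfKernel (choiKernel Φ))
  have hw : Countable w := countable_of_hilbertBasis hΦ hK b
  let e : Shrink.{0} w ≃ w := (equivShrink.{0} w).symm
  refine ⟨Shrink.{0} w, e.injective.countable, fun i => evalCLM hΦ hK (b (e i)), fun T =>
    e.hasSum_iff.mpr (isKrausSum_evalCLM hΦ hK b T), fun _ =>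
    card_le_of_linearIndependent hΦ hK (b.orthonormal.linearIndependent.comp e e.injective)⟩

end Kernel

/-! ### Normalization of Kraus families -/

section Coexist

variable [CompleteSpace H] {ι : Type*} {X : ι → H →L[ℂ] H}

theorem IsKrausSum.hasSum_norm_sq {Φ : TraceClass H →ₗ[ℂ] TraceClass H} (h : IsKrausSum Φ X)
    (v : H) : HasSum (fun j => ‖X j v‖ ^ 2) (Φ (TraceClass.ketBra v v)).trace.re := by
  have h1 := ((h (TraceClass.ketBra v v)).mapL (TraceClass.traceCLM H)).mapL Complex.reCLM
  simpa only [TraceClass.conj_ketBra, TraceClass.traceCLM_apply, TraceClass.trace_ketBra,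
    inner_self_eq_ofReal, Complex.reCLM_apply, Complex.ofReal_re] using h1

theorem inner_sum_adjoint_apply (s : Finset ι) (v w : H) :
    ⟪w, ∑ j ∈ s, (X j).adjoint (X j v)⟫_ℂ = ∑ j ∈ s, ⟪X j w, X j v⟫_ℂ := by
  rw [inner_sum]
  exact Finset.sum_congr rfl fun j _ => ContinuousLinearMap.adjoint_inner_right _ _ _

/-- For the partial sums `S` of `∑ j, (X j)* (X j)`, the inequality `S ^ 2 ≤ S`. -/
theorem IsSubnormalized.norm_sum_adjoint_apply_sq_le (hX : IsSubnormalized X) (s : Finset ι)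
    (v : H) : ‖∑ j ∈ s, (X j).adjoint (X j v)‖ ^ 2 ≤ ∑ j ∈ s, ‖X j v‖ ^ 2 := by
  set w := ∑ j ∈ s, (X j).adjoint (X j v) with hw
  have h1 : ‖w‖ ^ 2 ≤ ∑ j ∈ s, ‖X j w‖ * ‖X j v‖ := by
    have h2 := congrArg norm (inner_sum_adjoint_apply (X := X) s v w)
    rw [← hw, inner_self_eq_ofReal, Complex.norm_real, norm_pow, norm_norm] at h2
    rw [h2]
    exact (norm_sum_le _ _).trans (Finset.sum_le_sum fun j _ => norm_inner_le_norm _ _)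
  have h2 : (‖w‖ ^ 2) ^ 2 ≤ ‖w‖ ^ 2 * ∑ j ∈ s, ‖X j v‖ ^ 2 := by
    calc (‖w‖ ^ 2) ^ 2 ≤ (∑ j ∈ s, ‖X j w‖ * ‖X j v‖) ^ 2 := by gcongr
      _ ≤ (∑ j ∈ s, ‖X j w‖ ^ 2) * ∑ j ∈ s, ‖X j v‖ ^ 2 := Finset.sum_mul_sq_le_sq_mul_sq _ _ _
      _ ≤ ‖w‖ ^ 2 * ∑ j ∈ s, ‖X j v‖ ^ 2 := by
          gcongr
          exact hX s w
  rcases (sq_nonneg ‖w‖).eq_or_lt with h0 | h0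
  · rw [← h0]
    positivity
  · rw [sq (‖w‖ ^ 2)] at h2
    exact le_of_mul_le_mul_left h2 h0

/-- Weak convergence of `∑ j, (X j)* (X j)` to the identity implies strong convergence. -/
theorem isNormalized_of_hasSum_norm_sq (h : ∀ v, HasSum (fun j => ‖X j v‖ ^ 2) (‖v‖ ^ 2)) :
    IsNormalized X := fun v => by
  have hX : IsSubnormalized X := .of_hasSum fun v => ⟨_, le_rfl, h v⟩
  have hlim : Filter.Tendsto (fun s => ‖v‖ ^ 2 - ∑ j ∈ s, ‖X j v‖ ^ 2) Filter.atTop (nhds 0) := by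
    rw [← sub_self (‖v‖ ^ 2)]
    exact Filter.Tendsto.const_sub _ (h v)
  have hle (s : Finset ι) : ‖∑ j ∈ s, (X j).adjoint (X j v) - v‖ ^ 2 ≤
      ‖v‖ ^ 2 - ∑ j ∈ s, ‖X j v‖ ^ 2 := by
    have h1 := hX.norm_sum_adjoint_apply_sq_le s v
    have h2 : RCLike.re ⟪v, ∑ j ∈ s, (X j).adjoint (X j v)⟫_ℂ = ∑ j ∈ s, ‖X j v‖ ^ 2 := by
      rw [inner_sum_adjoint_apply]
      simp only [inner_self_eq_ofReal, ← Complex.ofReal_sum]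
      exact Complex.ofReal_re _
    rw [norm_sub_rev, norm_sub_sq (𝕜 := ℂ), h2]
    linarith
  rw [HasSum, SummationFilter.unconditional_filter, tendsto_iff_norm_sub_tendsto_zero]
  have h0 := squeeze_zero (fun _ => sq_nonneg _) hle hlim
  simpa using h0.sqrt

/-- A finite family with `∑ j, (X j)* (X j) ≤ I` is completed to a normalized one by the single
operator `(I - ∑ j, (X j)* (X j)) ^ (1 / 2)`. -/
theorem IsSubnormalized.exists_complement [Fintype ι] (hX : IsSubnormalized X) :
    ∃ Y : H →L[ℂ] H, ∀ v, ‖Y v‖ ^ 2 = ‖v‖ ^ 2 - ∑ j, ‖X j v‖ ^ 2 := by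
  let T : H →L[ℂ] H := 1 - ∑ j, (X j).adjoint ∘L X j
  have hT (v : H) : ⟪v, T v⟫_ℂ = ((‖v‖ ^ 2 - ∑ j, ‖X j v‖ ^ 2 : ℝ) : ℂ) := by
    have h1 : T v = v - ∑ j, (X j).adjoint (X j v) := by simp [T]
    rw [h1, inner_sub_right, inner_sum_adjoint_apply]
    simp only [inner_self_eq_ofReal]
    push_cast
    rfl
  have hpos : 0 ≤ T := by
    rw [ContinuousLinearMap.nonneg_iff_isPositive, ContinuousLinearMap.isPositive_iff_complex]
    intro v
    rw [← inner_conj_symm, hT, Complex.conj_ofReal]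
    refine ⟨rfl, ?_⟩
    exact sub_nonneg.mpr (hX Finset.univ v)
  obtain ⟨Y, hY⟩ := CStarAlgebra.nonneg_iff_eq_star_mul_self.mp hpos
  refine ⟨Y, fun v => ?_⟩
  have h1 := hT v
  rw [hY, _root_.mul_apply_eq_comp, ContinuousLinearMap.star_eq_adjoint,
    ContinuousLinearMap.adjoint_inner_right, inner_self_eq_ofReal] at h1
  exact_mod_cast h1

/-! ### Coexistent operations -/

section Instrument

variable {Ω : Type w} [MeasurableSpace Ω] {J : Set Ω → TraceClass H →ₗ[ℂ] TraceClass H}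

theorem IsInstrument.map_empty (hJ : IsInstrument J) : J ∅ = 0 := by
  ext1 T
  have h := hJ.sigma_additive (fun _ => ∅) (fun _ => .empty) (fun _ _ _ => by simp) T
  exact tendsto_nhds_unique tendsto_const_nhds h.summable.tendsto_atTop_zero

/-- Finite additivity, by viewing `A ↦ J A T` as a vector measure. -/
theorem IsInstrument.map_union (hJ : IsInstrument J) {A B : Set Ω} (hA : MeasurableSet A)
    (hB : MeasurableSet B) (hAB : Disjoint A B) : J (A ∪ B) = J A + J B := by
  classical
  ext1 T
  let μ : MeasureTheory.VectorMeasure Ω (TraceClass H) :=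
    { measureOf' := fun C => if MeasurableSet C then J C T else 0
      empty' := by simp [hJ.map_empty]
      not_measurable' := fun C hC => if_neg hC
      m_iUnion' := fun C hC hd => by
        simp only [hC, MeasurableSet.iUnion hC, if_true]
        exact hJ.sigma_additive C hC hd T }
  have hμ {C : Set Ω} (hC : MeasurableSet C) : μ C = J C T := if_pos hC
  have h := MeasureTheory.VectorMeasure.of_union (v := μ) hAB hA hB
  rwa [hμ (hA.union hB), hμ hA, hμ hB] at h

theorem IsInstrument.trace_univ_of_isPositive (hJ : IsInstrument J) {S : TraceClass H}
    (hS : S.toCLM.IsPositive) : (J Set.univ S).trace = S.trace := by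
  rcases exists_isState_smul_eq hS with rfl | ⟨ρ, hρ, h⟩
  · rw [map_zero]
  · conv_lhs => rw [← h]
    rw [trace_map_smul, hJ.trace_univ ρ hρ, mul_one]

end Instrument

/-- Coexistent operations have a common refinement, the values of the instrument at the four atoms
`A ∩ B`, `A \ B`, `B \ A`, `(A ∪ B)ᶜ`. -/
theorem Coexistent.exists_refinement {Φ Ψ : TraceClass H →ₗ[ℂ] TraceClass H}
    (h : Coexistent.{w} Φ Ψ) :
    ∃ Θ : Fin 4 → TraceClass H →ₗ[ℂ] TraceClass H, (∀ k, IsOperation (Θ k)) ∧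
      Φ = Θ 0 + Θ 1 ∧ Ψ = Θ 0 + Θ 2 ∧
      ∀ v, ∑ k, (Θ k (TraceClass.ketBra v v)).trace.re = ‖v‖ ^ 2 := by
  obtain ⟨Ω, _, J, hJ, ⟨A, hA, rfl⟩, B, hB, rfl⟩ := h
  have hAB : J A = J (A ∩ B) + J (A \ B) := by
    rw [← hJ.map_union (hA.inter hB) (hA.diff hB) Set.disjoint_sdiff_inter.symm,
      Set.inter_union_sdiff]
  have hBA : J B = J (A ∩ B) + J (B \ A) := by
    rw [Set.inter_comm, ← hJ.map_union (hB.inter hA) (hB.diff hA) Set.disjoint_sdiff_inter.symm,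
      Set.inter_union_sdiff]
  have huniv : J Set.univ = J A + J (B \ A) + J (A ∪ B)ᶜ := by
    rw [← hJ.map_union hA (hB.diff hA) Set.disjoint_sdiff_right, Set.union_sdiff_self,
      ← hJ.map_union (hA.union hB) (hA.union hB).compl disjoint_compl_right, Set.union_compl_self]
  refine ⟨![J (A ∩ B), J (A \ B), J (B \ A), J (A ∪ B)ᶜ], ?_, hAB, hBA, fun v => ?_⟩
  · intro k
    fin_cases k
    · exact hJ.isOperation _ (hA.inter hB)
    · exact hJ.isOperation _ (hA.diff hB)
    · exact hJ.isOperation _ (hB.diff hA)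
    · exact hJ.isOperation _ (hA.union hB).compl
  · have h1 := hJ.trace_univ_of_isPositive (isPositive_toCLM_ketBra v)
    rw [TraceClass.trace_ketBra, inner_self_eq_ofReal, huniv, hAB] at h1
    have h2 := congrArg Complex.re h1
    simp only [← TraceClass.traceCLM_apply, LinearMap.add_apply, map_add, Complex.add_re,
      Complex.ofReal_re] at h2
    simp only [Fin.sum_univ_four, ← TraceClass.traceCLM_apply]
    exact h2

/-- Kraus families of the first three parts of a common refinement, together with a family that
accounts for the missing normalization, are assembled to one family. -/
theorem exists_common_kraus {ι₀ ι₁ ι₂ ι₃ : Type} {X₀ : ι₀ → H →L[ℂ] H} {X₁ : ι₁ → H →L[ℂ] H}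
    {X₂ : ι₂ → H →L[ℂ] H} {X₃ : ι₃ → H →L[ℂ] H} {Θ₀ Θ₁ Θ₂ : TraceClass H →ₗ[ℂ] TraceClass H}
    (h₀ : IsKrausSum Θ₀ X₀) (h₁ : IsKrausSum Θ₁ X₁) (h₂ : IsKrausSum Θ₂ X₂) {r : H → ℝ}
    (h₃ : ∀ v, HasSum (fun j => ‖X₃ j v‖ ^ 2) (r v))
    (hr : ∀ v, (Θ₀ (TraceClass.ketBra v v)).trace.re + (Θ₁ (TraceClass.ketBra v v)).trace.re +
      (Θ₂ (TraceClass.ketBra v v)).trace.re + r v = ‖v‖ ^ 2) :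
    ∃ (X : ((ι₀ ⊕ ι₁) ⊕ ι₂) ⊕ ι₃ → H →L[ℂ] H) (J₁ J₂ : Set (((ι₀ ⊕ ι₁) ⊕ ι₂) ⊕ ι₃)),
      IsKrausSum (Θ₀ + Θ₁) (fun j : J₁ => X j) ∧ IsKrausSum (Θ₀ + Θ₂) (fun j : J₂ => X j) ∧
        IsNormalized X := by
  let X : ((ι₀ ⊕ ι₁) ⊕ ι₂) ⊕ ι₃ → H →L[ℂ] H := Sum.elim (Sum.elim (Sum.elim X₀ X₁) X₂) X₃
  have hinj : Function.Injective
      (Sum.inl ∘ Sum.map Sum.inl id : ι₀ ⊕ ι₂ → ((ι₀ ⊕ ι₁) ⊕ ι₂) ⊕ ι₃) :=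
    Sum.inl_injective.comp (Sum.map_injective.mpr ⟨Sum.inl_injective, Function.injective_id⟩)
  refine ⟨X, Set.range (Sum.inl ∘ Sum.inl), Set.range (Sum.inl ∘ Sum.map Sum.inl id),
    fun T => ?_, fun T => ?_, isNormalized_of_hasSum_norm_sq fun v => ?_⟩
  · refine ((Sum.inl_injective.comp Sum.inl_injective).hasSum_range_iff
      (f := fun j => TraceClass.conj (X j) T)).mpr ?_
    exact HasSum.sum (h₀ T) (h₁ T)
  · refine (hinj.hasSum_range_iff (f := fun j => TraceClass.conj (X j) T)).mpr ?_
    exact HasSum.sum (h₀ T) (h₂ T)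
  · rw [← hr v]
    exact HasSum.sum (HasSum.sum (HasSum.sum (h₀.hasSum_norm_sq v) (h₁.hasSum_norm_sq v))
      (h₂.hasSum_norm_sq v)) (h₃ v)

theorem Coexistent.exists_countable_kraus [TopologicalSpace.SeparableSpace H]
    {Φ Ψ : TraceClass H →ₗ[ℂ] TraceClass H} (h : Coexistent.{w} Φ Ψ) :
    ∃ (J : Type) (_ : Countable J) (X : J → H →L[ℂ] H) (J₁ J₂ : Set J),
      IsKrausSum Φ (fun j : J₁ => X j) ∧ IsKrausSum Ψ (fun j : J₂ => X j) ∧ IsNormalized X := by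
  obtain ⟨Θ, hΘ, rfl, rfl, hsum⟩ := h.exists_refinement
  choose ι hι X hX _ using fun k => (hΘ k).exists_isKrausSum
  have := hι 0
  have := hι 1
  have := hι 2
  have := hι 3
  exact ⟨_, inferInstance, exists_common_kraus (hX 0) (hX 1) (hX 2) (hX 3).hasSum_norm_sq
    fun v => (Fin.sum_univ_four _).symm.trans (hsum v)⟩

/-- The fourth part of the common refinement enters only through the normalization, so that a single
operator can stand for its Kraus family. -/
theorem Coexistent.exists_finite_kraus [FiniteDimensional ℂ H]
    {Φ Ψ : TraceClass H →ₗ[ℂ] TraceClass H} (h : Coexistent.{w} Φ Ψ) :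
    ∃ (J : Type) (_ : Fintype J) (X : J → H →L[ℂ] H) (J₁ J₂ : Set J),
      Fintype.card J ≤ 3 * Module.finrank ℂ H ^ 2 + 1 ∧
      IsKrausSum Φ (fun j : J₁ => X j) ∧ IsKrausSum Ψ (fun j : J₂ => X j) ∧ IsNormalized X := by
  have : TopologicalSpace.SeparableSpace H := by
    have := FiniteDimensional.proper ℂ H
    infer_instance
  obtain ⟨Θ, hΘ, rfl, rfl, hsum⟩ := h.exists_refinement
  choose ι _ X hX hcard using fun k => (hΘ k).exists_isKrausSum
  have hfin (k : Fin 4) : Finite (ι k) := (hcard k inferInstance).1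
  have hle (k : Fin 4) : Nat.card (ι k) ≤ Module.finrank ℂ H ^ 2 := (hcard k inferInstance).2
  let _ (k : Fin 4) : Fintype (ι k) := Fintype.ofFinite _
  let Z : (ι 0 ⊕ ι 1) ⊕ ι 2 → H →L[ℂ] H := Sum.elim (Sum.elim (X 0) (X 1)) (X 2)
  have hZ (v : H) : HasSum (fun j => ‖Z j v‖ ^ 2)
      (‖v‖ ^ 2 - (Θ 3 (TraceClass.ketBra v v)).trace.re) := by
    have h1 := HasSum.sum (f := fun j => ‖Z j v‖ ^ 2)
      (HasSum.sum ((hX 0).hasSum_norm_sq v) ((hX 1).hasSum_norm_sq v)) ((hX 2).hasSum_norm_sq v)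
    rwa [← hsum v, Fin.sum_univ_four, add_sub_cancel_right]
  have hZsub : IsSubnormalized Z := .of_hasSum fun v => by
    refine ⟨_, sub_le_self _ ?_, hZ v⟩
    exact ((hX 3).hasSum_norm_sq v).nonneg fun _ => sq_nonneg _
  obtain ⟨Y, hY⟩ := hZsub.exists_complement
  have hY' (v : H) : HasSum (fun _ : Unit => ‖Y v‖ ^ 2) (Θ 3 (TraceClass.ketBra v v)).trace.re := by
    have h1 := (hZ v).unique (hasSum_fintype _)
    have h2 : ‖Y v‖ ^ 2 = (Θ 3 (TraceClass.ketBra v v)).trace.re := by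
      rw [hY, ← h1, sub_sub_cancel]
    rw [← h2]
    exact hasSum_unique _
  obtain ⟨V, J₁, J₂, hV⟩ := exists_common_kraus (X₃ := fun _ => Y) (hX 0) (hX 1) (hX 2) hY'
    fun v => (Fin.sum_univ_four _).symm.trans (hsum v)
  refine ⟨_, inferInstance, V, J₁, J₂, ?_, hV⟩
  have h0 := hle 0
  have h1 := hle 1
  have h2 := hle 2
  rw [Nat.card_eq_fintype_card] at h0 h1 h2
  simp only [Fintype.card_sum, Fintype.card_unit]
  lia

end Coexist

end QOp

end


theorem proposition2 {H : Type u} [NormedAddCommGroup H] [InnerProductSpace ℂ H] [CompleteSpace H]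
    [TopologicalSpace.SeparableSpace H]
    (Φ Ψ : QOp.TraceClass H →ₗ[ℂ] QOp.TraceClass H)
    (hΦ : QOp.IsOperation Φ) (hΨ : QOp.IsOperation Ψ) :
    (QOp.Coexistent.{w} Φ Ψ ↔
      ∃ (J : Type) (_ : Countable J) (X : J → H →L[ℂ] H) (J₁ J₂ : Set J),
        QOp.IsKrausSum Φ (fun j : J₁ => X j) ∧
        QOp.IsKrausSum Ψ (fun j : J₂ => X j) ∧
        QOp.IsNormalized X) ∧
    (FiniteDimensional ℂ H → QOp.Coexistent.{w} Φ Ψ →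
      ∃ (J : Type) (_ : Fintype J) (X : J → H →L[ℂ] H) (J₁ J₂ : Set J),
        Fintype.card J ≤ 3 * Module.finrank ℂ H ^ 2 + 1 ∧
        QOp.IsKrausSum Φ (fun j : J₁ => X j) ∧
        QOp.IsKrausSum Ψ (fun j : J₂ => X j) ∧
        QOp.IsNormalized X) := by
  refine ⟨⟨fun h => h.exists_countable_kraus, ?_⟩, fun _ h => h.exists_finite_kraus⟩
  rintro ⟨J, _, X, J₁, J₂, h₁, h₂, hX⟩
  exact QOp.coexistent_of_isKrausSum hX h₁ h₂
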